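/- Let $C^\infty_{c,r}(\mathbb{R}^n)$ denote the smooth, compactly supported, radial functions $\mathbb{R}^n\to\mathbb{C}$. With $\mathcal{F}u(\xi)=(2\pi)^{-n/2}\int_{\mathbb{R}^n}u(x)e^{-i\xi\cdot x}\,dx$, put for $s\ge 0$ $$\langle u,v\rangle_{\dot H^s}=\big\langle |\cdot|^s\mathcal{F}u,\,|\cdot|^s\mathcal{F}v\big\rangle_{L^2(\mathbb{R}^n)},$$ and for $0\le s_1\le s_2$ let $\langle u,v\rangle_{\dot H^{s_1}\cap\dot H^{s_2}}=\langle u,v\rangle_{\dot H^{s_1}}+\langle u,v\rangle_{\dot H^{s_2}}$ if $s_1<s_2$, and $\langle u,v\rangle_{\dot H^{s_1}\cap\dot H^{s_2}}=\langle u,v\rangle_{\dot H^{s_1}}$ if $s_1=s_2$. For $1\le s_1\le s_2$ let $\mathcal{H}^{s_1,s_2}$ be the completion of $C^\infty_{c,r}(\mathbb{R}^n)\times C^\infty_{c,r}(\mathbb{R}^n)$ under the norm induced by the inner product $$\langle (u_1,u_2),(v_1,v_2)\rangle=\langle u_1,v_1\rangle_{\dot H^{s_1}\cap\dot H^{s_2}}+\langle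 u_2,v_2\rangle_{\dot H^{s_1-1}\cap\dot H^{s_2-1}}.$$ **Lemma 4.1.** Let $n\ge 5$, $1<s_1<\frac n2$ and $s_1\le s_2$. Let $V:\mathbb{R}^n\to\mathbb{C}$ be smooth and radial, and suppose that for every multi-index $\alpha\in\mathbb{N}_0^n$ there is a constant $C_\alpha$ with $$|\partial^\alpha V(x)|\le C_\alpha\,(1+|x|^2)^{-\frac{2+|\alpha|}{2}}\qquad\text{for all }x\in\mathbb{R}^n.$$ Then the mapping $$(u_1,u_2)\mapsto(0,\,Vu_1),\qquad u_1,u_2\in C^\infty_{c,r}(\mathbb{R}^n),$$ extends (necessarily uniquely, by density) to a bounded linear operator on $\mathcal{H}^{s_1,s_2}$. If, in addition, $s_2<\frac n2$, then this operator is compact. -/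

import Mathlib

open MeasureTheory
open scoped ContDiff FourierTransform

noncomputable section

/-- A function on `ℝⁿ` is radial if its value at `x` depends only on `|x|`. -/
def IsRadial {n : ℕ} (u : EuclideanSpace ℝ (Fin n) → ℂ) : Prop :=
  ∀ x y, ‖x‖ = ‖y‖ → u x = u y

/-- The radial test space `C^∞_{c,r}(ℝⁿ)`: smooth, compactly supported, radial, complex valued. -/
def RadialTest (n : ℕ) : Submodule ℂ (EuclideanSpace ℝ (Fin n) → ℂ) where
  carrier := {u | ContDiff ℝ ∞ u ∧ HasCompactSupport u ∧ IsRadial u}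
  zero_mem' := ⟨contDiff_const, HasCompactSupport.zero, fun _ _ _ => rfl⟩
  add_mem' := fun {u v} hu hv => ⟨hu.1.add hv.1, hu.2.1.add hv.2.1, fun x y h => by
    simp [hu.2.2 x y h, hv.2.2 x y h]⟩
  smul_mem' := fun c u hu => ⟨hu.1.const_smul c, hu.2.1.smul_left (f := fun _ => c),
    fun x y h => by simp [hu.2.2 x y h]⟩

/-- The Fourier transform in the normalization
`𝓕u(ξ) = (2π)^{-n/2} ∫ u(x) e^{-i ξ·x} dx`. -/
def fourierT {n : ℕ} (u : EuclideanSpace ℝ (Fin n) → ℂ) (ξ : EuclideanSpace ℝ (Fin n)) : ℂ :=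
  (((2 * Real.pi) ^ (-(n : ℝ) / 2) : ℝ) : ℂ) *
    ∫ x, u x * Complex.exp (-Complex.I * ((inner ℝ ξ x : ℝ) : ℂ))

/-- The homogeneous Sobolev inner product
`⟨u, v⟩_{Ḣˢ} = ⟨|·|ˢ 𝓕u, |·|ˢ 𝓕v⟩_{L²}` (conjugate linear in the first entry). -/
def hsobInner {n : ℕ} (s : ℝ) (u v : EuclideanSpace ℝ (Fin n) → ℂ) : ℂ :=
  ∫ ξ, inner ℂ (((‖ξ‖ ^ s : ℝ) : ℂ) * fourierT u ξ) (((‖ξ‖ ^ s : ℝ) : ℂ) * fourierT v ξ)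

/-- The inner product of `Ḣ^{s₁} ∩ Ḣ^{s₂}`; the second term is present only if `s₁ < s₂`. -/
def interInner {n : ℕ} (s₁ s₂ : ℝ) (u v : EuclideanSpace ℝ (Fin n) → ℂ) : ℂ :=
  hsobInner s₁ u v + if s₁ < s₂ then hsobInner s₂ u v else 0

/-! ### The integrals above converge on the test space -/

lemma fourierT_eq {n : ℕ} (f : SchwartzMap (EuclideanSpace ℝ (Fin n)) ℂ)
    (ξ : EuclideanSpace ℝ (Fin n)) :
    fourierT f ξ = (((2 * Real.pi) ^ (-(n : ℝ) / 2) : ℝ) : ℂ) *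
      (𝓕 f) ((2 * Real.pi)⁻¹ • ξ) := by
  rw [fourierT, SchwartzMap.fourier_coe, Real.fourier_eq']
  congr 2
  ext x
  have hpi : Real.pi ≠ 0 := Real.pi_ne_zero
  have h : -2 * Real.pi * ((2 * Real.pi)⁻¹ * inner ℝ ξ x) = - inner ℝ ξ x := by
    field_simp
  rw [smul_eq_mul, mul_comm, inner_smul_right, real_inner_comm ξ x, h]
  congr 2
  push_cast
  ring

/-- The Fourier transform of a test function, as a Schwartz function. -/
lemma RadialTest.exists_schwartz {n : ℕ} (u : RadialTest n) :
    ∃ g : SchwartzMap (EuclideanSpace ℝ (Fin n)) ℂ,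
      ∀ ξ, fourierT u.1 ξ = g ((2 * Real.pi)⁻¹ • ξ) := by
  refine ⟨(((2 * Real.pi) ^ (-(n : ℝ) / 2) : ℝ) : ℂ) • 𝓕 (u.2.2.1.toSchwartzMap u.2.1), ?_⟩
  intro ξ
  exact fourierT_eq (u.2.2.1.toSchwartzMap u.2.1) ξ

lemma fourierT_add {n : ℕ} (u v : RadialTest n) (ξ : EuclideanSpace ℝ (Fin n)) :
    fourierT (u.1 + v.1) ξ = fourierT u.1 ξ + fourierT v.1 ξ := by
  have h := fourierT_eq (u.2.2.1.toSchwartzMap u.2.1 + v.2.2.1.toSchwartzMap v.2.1) ξ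
  have hu := fourierT_eq (u.2.2.1.toSchwartzMap u.2.1) ξ
  have hv := fourierT_eq (v.2.2.1.toSchwartzMap v.2.1) ξ
  have e : fourierT (u.1 + v.1) ξ =
    fourierT (u.2.2.1.toSchwartzMap u.2.1 + v.2.2.1.toSchwartzMap v.2.1 :
      SchwartzMap (EuclideanSpace ℝ (Fin n)) ℂ) ξ := rfl
  have eu : fourierT u.1 ξ = fourierT (u.2.2.1.toSchwartzMap u.2.1) ξ := rfl
  have ev : fourierT v.1 ξ = fourierT (v.2.2.1.toSchwartzMap v.2.1) ξ := rfl
  rw [e, eu, ev, h, hu, hv, FourierTransform.fourier_add, add_apply, mul_add]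

lemma fourierT_smul {n : ℕ} (c : ℂ) (u : EuclideanSpace ℝ (Fin n) → ℂ)
    (ξ : EuclideanSpace ℝ (Fin n)) :
    fourierT (c • u) ξ = c * fourierT u ξ := by
  simp only [fourierT, Pi.smul_apply, smul_eq_mul, mul_assoc, integral_const_mul]
  ring

lemma integrable_hsobInner {n : ℕ} {s : ℝ} (hs : 0 ≤ s) (u v : RadialTest n) :
    Integrable (fun ξ : EuclideanSpace ℝ (Fin n) =>
      inner ℂ (((‖ξ‖ ^ s : ℝ) : ℂ) * fourierT u.1 ξ)
        (((‖ξ‖ ^ s : ℝ) : ℂ) * fourierT v.1 ξ)) := by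
  obtain ⟨f, hf⟩ := RadialTest.exists_schwartz u
  obtain ⟨g, hg⟩ := RadialTest.exists_schwartz v
  simp only [hf, hg]
  have hpi : (2 * Real.pi) ≠ 0 := by positivity
  -- after rescaling, compare with polynomial weights times Schwartz functions
  have key : Integrable (fun x : EuclideanSpace ℝ (Fin n) =>
      inner ℂ (((‖(2 * Real.pi) • x‖ ^ s : ℝ) : ℂ) * f x)
        (((‖(2 * Real.pi) • x‖ ^ s : ℝ) : ℂ) * g x)) := by
    obtain ⟨C, hC⟩ := f.decay 0 0
    have hC' : ∀ x, ‖f x‖ ≤ C := fun x => by simpa using hC.2 x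
    set N := ⌈2 * s⌉₊
    have hi : Integrable (fun x : EuclideanSpace ℝ (Fin n) =>
        ((2 * Real.pi) ^ (2 * s) * C) * (‖x‖ ^ 0 * ‖g x‖ + ‖x‖ ^ N * ‖g x‖)) :=
      ((g.integrable_pow_mul volume 0).add (g.integrable_pow_mul volume N)).const_mul _
    refine hi.mono' ?_ (Filter.Eventually.of_forall fun x => ?_)
    · have hc : Continuous (fun x : EuclideanSpace ℝ (Fin n) =>
          (((‖(2 * Real.pi) • x‖ ^ s : ℝ) : ℂ))) :=
        Complex.continuous_ofReal.comp
          ((continuous_norm.comp (continuous_const_smul _)).rpow_const fun _ => Or.inr hs)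
      exact ((hc.mul f.continuous).inner (hc.mul g.continuous)).aestronglyMeasurable
    · refine (norm_inner_le_norm _ _).trans ?_
      rw [norm_mul, norm_mul, Complex.norm_real, Real.norm_of_nonneg (by positivity), norm_smul,
        Real.norm_of_nonneg (by positivity : (0 : ℝ) ≤ 2 * Real.pi),
        Real.mul_rpow (by positivity) (norm_nonneg x)]
      have hx : ‖x‖ ^ s * ‖x‖ ^ s ≤ ‖x‖ ^ 0 + ‖x‖ ^ N := by
        rw [← Real.rpow_add_of_nonneg (norm_nonneg x) hs hs]
        rcases le_total ‖x‖ 1 with h | h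
        · have := Real.rpow_le_one (norm_nonneg x) h (by linarith : 0 ≤ s + s)
          have h2 : 0 ≤ ‖x‖ ^ N := by positivity
          simp only [pow_zero]; linarith
        · have h1 : s + s ≤ (N : ℝ) := by
            have := Nat.le_ceil (2 * s); linarith
          have := Real.rpow_le_rpow_of_exponent_le h h1
          rw [Real.rpow_natCast] at this
          simp only [pow_zero]; linarith
      have hp : (2 * Real.pi) ^ (2 * s) = (2 * Real.pi) ^ s * (2 * Real.pi) ^ s := by
        rw [← Real.rpow_add (by positivity)]; ring_nf
      have hC0 : 0 ≤ C := (norm_nonneg _).trans (hC' x)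
      calc (2 * Real.pi) ^ s * ‖x‖ ^ s * ‖f x‖ * ((2 * Real.pi) ^ s * ‖x‖ ^ s * ‖g x‖)
          = ((2 * Real.pi) ^ (2 * s) * ‖f x‖) * ((‖x‖ ^ s * ‖x‖ ^ s) * ‖g x‖) := by
            rw [hp]; ring
        _ ≤ ((2 * Real.pi) ^ (2 * s) * C) * ((‖x‖ ^ 0 + ‖x‖ ^ N) * ‖g x‖) := by
            gcongr
            exact hC' x
        _ = _ := by ring
  have := key.comp_smul (inv_ne_zero hpi)
  simpa only [smul_inv_smul₀ hpi] using this

lemma hsobInner_conj_symm {n : ℕ} (s : ℝ) (u v : EuclideanSpace ℝ (Fin n) → ℂ) :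
    (starRingEnd ℂ) (hsobInner s v u) = hsobInner s u v := by
  simp only [hsobInner, ← integral_conj, inner_conj_symm]

lemma hsobInner_self_nonneg {n : ℕ} (s : ℝ) (u : EuclideanSpace ℝ (Fin n) → ℂ) :
    0 ≤ RCLike.re (hsobInner s u u) := by
  have : hsobInner s u u =
      ((∫ ξ, ‖((‖ξ‖ ^ s : ℝ) : ℂ) * fourierT u ξ‖ ^ 2 : ℝ) : ℂ) := by
    rw [hsobInner, ← integral_complex_ofReal]
    congr 1
    ext ξ
    rw [inner_self_eq_norm_sq_to_K]
    push_cast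
    rfl
  rw [this]
  exact integral_nonneg fun _ => by positivity

lemma hsobInner_add_left {n : ℕ} {s : ℝ} (hs : 0 ≤ s) (u v w : RadialTest n) :
    hsobInner s (u.1 + v.1) w.1 = hsobInner s u.1 w.1 + hsobInner s v.1 w.1 := by
  simp only [hsobInner]
  rw [← integral_add (integrable_hsobInner hs u w) (integrable_hsobInner hs v w)]
  congr 1
  ext ξ
  rw [fourierT_add, mul_add, inner_add_left]

lemma hsobInner_smul_left {n : ℕ} (s : ℝ) (c : ℂ) (u v : EuclideanSpace ℝ (Fin n) → ℂ) :
    hsobInner s (c • u) v = (starRingEnd ℂ) c * hsobInner s u v := by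
  simp only [hsobInner, ← integral_const_mul]
  congr 1
  ext ξ
  rw [fourierT_smul, mul_left_comm, ← smul_eq_mul c, inner_smul_left]

lemma interInner_conj_symm {n : ℕ} (s₁ s₂ : ℝ) (u v : EuclideanSpace ℝ (Fin n) → ℂ) :
    (starRingEnd ℂ) (interInner s₁ s₂ v u) = interInner s₁ s₂ u v := by
  unfold interInner
  split_ifs <;> simp [hsobInner_conj_symm]

lemma interInner_self_nonneg {n : ℕ} (s₁ s₂ : ℝ) (u : EuclideanSpace ℝ (Fin n) → ℂ) :
    0 ≤ RCLike.re (interInner s₁ s₂ u u) := by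
  unfold interInner
  have h1 := hsobInner_self_nonneg s₁ u
  have h2 := hsobInner_self_nonneg s₂ u
  split_ifs
  · rw [map_add]; exact add_nonneg h1 h2
  · simpa using h1

lemma interInner_add_left {n : ℕ} {s₁ s₂ : ℝ} (h₁ : 0 ≤ s₁) (h : s₁ ≤ s₂)
    (u v w : RadialTest n) :
    interInner s₁ s₂ (u.1 + v.1) w.1 = interInner s₁ s₂ u.1 w.1 + interInner s₁ s₂ v.1 w.1 := by
  unfold interInner
  split_ifs
  · rw [hsobInner_add_left h₁, hsobInner_add_left (h₁.trans h)]; ring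
  · rw [hsobInner_add_left h₁]; ring

lemma interInner_smul_left {n : ℕ} (s₁ s₂ : ℝ) (c : ℂ) (u v : EuclideanSpace ℝ (Fin n) → ℂ) :
    interInner s₁ s₂ (c • u) v = (starRingEnd ℂ) c * interInner s₁ s₂ u v := by
  unfold interInner
  split_ifs <;> simp only [hsobInner_smul_left] <;> ring

/-! ### The space `𝓗^{s₁,s₂}` -/

/-- Pairs `(u₁, u₂)` of radial test functions, carrying the inner product
`⟨u₁, v₁⟩_{Ḣ^{s₁} ∩ Ḣ^{s₂}} + ⟨u₂, v₂⟩_{Ḣ^{s₁-1} ∩ Ḣ^{s₂-1}}` given below. -/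
@[nolint unusedArguments]
def TestPair (n : ℕ) (s₁ s₂ : ℝ) (_h₁ : 1 ≤ s₁) (_h : s₁ ≤ s₂) : Type :=
  RadialTest n × RadialTest n

namespace TestPair

variable {n : ℕ} {s₁ s₂ : ℝ} {h₁ : 1 ≤ s₁} {h : s₁ ≤ s₂}

instance : AddCommGroup (TestPair n s₁ s₂ h₁ h) :=
  inferInstanceAs (AddCommGroup (RadialTest n × RadialTest n))

instance : Module ℂ (TestPair n s₁ s₂ h₁ h) :=
  inferInstanceAs (Module ℂ (RadialTest n × RadialTest n))

/-- The pair `(u₁, u₂)`. -/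
def mk (u₁ u₂ : RadialTest n) : TestPair n s₁ s₂ h₁ h := (u₁, u₂)

/-- The first component. -/
def fst (u : TestPair n s₁ s₂ h₁ h) : RadialTest n := Prod.fst u

/-- The second component. -/
def snd (u : TestPair n s₁ s₂ h₁ h) : RadialTest n := Prod.snd u

/-- The inner product of `𝓗^{s₁,s₂}` on pairs of test functions. -/
abbrev core : PreInnerProductSpace.Core ℂ (TestPair n s₁ s₂ h₁ h) where
  inner u v := interInner s₁ s₂ u.fst.1 v.fst.1 + interInner (s₁ - 1) (s₂ - 1) u.snd.1 v.snd.1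
  conj_inner_symm u v := by simp [interInner_conj_symm]
  re_inner_nonneg u := by
    rw [map_add]
    exact add_nonneg (interInner_self_nonneg _ _ _) (interInner_self_nonneg _ _ _)
  add_left u v w := by
    change interInner s₁ s₂ (u.fst.1 + v.fst.1) w.fst.1 +
      interInner (s₁ - 1) (s₂ - 1) (u.snd.1 + v.snd.1) w.snd.1 = _
    rw [interInner_add_left (by linarith) h, interInner_add_left (by linarith) (by linarith)]
    ring
  smul_left u v c := by
    change interInner s₁ s₂ (c • u.fst.1) v.fst.1 +
      interInner (s₁ - 1) (s₂ - 1) (c • u.snd.1) v.snd.1 = _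
    rw [interInner_smul_left, interInner_smul_left]
    ring

/-- The induced norm `‖u‖ = ⟨u, u⟩^{1/2}`. -/
instance : SeminormedAddCommGroup (TestPair n s₁ s₂ h₁ h) :=
  @InnerProductSpace.Core.toSeminormedAddCommGroup ℂ _ _ _ _ core

instance : InnerProductSpace ℂ (TestPair n s₁ s₂ h₁ h) :=
  InnerProductSpace.ofCore core

lemma inner_def (u v : TestPair n s₁ s₂ h₁ h) :
    inner ℂ u v =
      interInner s₁ s₂ u.fst.1 v.fst.1 + interInner (s₁ - 1) (s₂ - 1) u.snd.1 v.snd.1 := rfl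

end TestPair

/-- The Hilbert space `𝓗^{s₁,s₂}`: the completion of the pairs of radial test functions. -/
abbrev EnergySpace (n : ℕ) (s₁ s₂ : ℝ) (h₁ : 1 ≤ s₁) (h : s₁ ≤ s₂) : Type :=
  UniformSpace.Completion (TestPair n s₁ s₂ h₁ h)

/-- The product `V u` of a smooth radial function `V` with a radial test function `u`. -/
def RadialTest.mulLeft {n : ℕ} (V : EuclideanSpace ℝ (Fin n) → ℂ) (hV : ContDiff ℝ ∞ V)
    (hVr : IsRadial V) (u : RadialTest n) : RadialTest n :=
  ⟨fun x => V x * u.1 x, hV.mul u.2.1, u.2.2.1.mul_left, fun x y h => by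
    change V x * u.1 x = V y * u.1 y
    rw [hVr x y h, u.2.2.2 x y h]⟩

end

open scoped ENNReal SchwartzMap

/-! Everything reduces to test functions. With a = s₁ and t = s₁ - 1 or t = s₂ - 1, one needs
‖Vu‖_{Ḣ^t} ≤ C(‖u‖_{Ḣ^a} + ‖u‖_{Ḣ^{t+1}}) and compactness of u ↦ |·|^t 𝓕(Vu) into L².

On the Fourier side the product is a convolution, and |ξ|^t ≤ 2^t(|ξ-η|^t + |η|^t). If
|ζ|^{t+n-a}|φ̂(ζ)| and |ζ|^{n-b}|φ̂(ζ)| are bounded, the two halves are dominated by the kernels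
|ξ-η|^{a-n}|η|^{-a} and |ξ-η|^{b-n}|η|^{-b}, acting on |η|^a|û| and |η|^{t+b}|û|. Such kernels are
bounded on L² for exponents in (0, n/2), by Schur's test with weight |η|^{-n/2}
(`eLpNorm_riesz_mul_rpow_le`, `exists_hsobENorm_mul_le`).

The bounds on φ̂ come from L¹ norms of derivatives of φ. A symbol of order -2 has integrable
derivatives from order n - 1 on, which suffices when a ≤ t + 1 and b ≤ 1. Half a power is left over,
so the part of V beyond radius R has norm O(R^{-1/2}) (`IsSymbolNegTwo.exists_hsobENorm_tail_le`).

For compactness this leaves a compactly supported factor φ. Taking b = 1/2 controls φu in Ḣ^{t+1/2},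
so frequencies beyond r contribute O(r^{-1/2}). On |ξ| ≤ r, the value 𝓕(φu)(ξ) is a functional of u
depending continuously on ξ, so the truncated operator has a square integrable dual-valued kernel
and is compact (`isCompactOperator_kernelOperator`). Norm limits stay compact, and total boundedness
of the image of the unit ball carries this over to the completion. -/

lemma ENNReal.rpow_neg_le_of_le_mul {c x y : ℝ≥0∞} (hc : c ≠ 0) (hc' : c ≠ ⊤) {q : ℝ}
    (hq : 0 ≤ q) (h : y ≤ c * x) : x ^ (-q) ≤ c ^ q * y ^ (-q) := by
  have h1 : y ^ q ≤ c ^ q * x ^ q := by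
    rw [← ENNReal.mul_rpow_of_nonneg _ _ hq]
    gcongr
  have hcq : c ^ q ≠ 0 := by simp [ENNReal.rpow_eq_zero_iff, hc, hc']
  have hcq' : c ^ q ≠ ⊤ := ENNReal.rpow_ne_top_of_nonneg hq hc'
  rw [ENNReal.rpow_neg, ENNReal.rpow_neg]
  calc (x ^ q)⁻¹ = c ^ q * (c ^ q * x ^ q)⁻¹ := by
        rw [ENNReal.mul_inv (Or.inl hcq) (Or.inl hcq'), ← mul_assoc,
          ENNReal.mul_inv_cancel hcq hcq', one_mul]
    _ ≤ c ^ q * (y ^ q)⁻¹ := by gcongr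

/-- Schur's test for a kernel with weight function `h`. -/
lemma lintegral_sq_le_of_schur {α : Type*} [MeasurableSpace α] {μ : Measure α} [SFinite μ]
    {K : α → α → ℝ≥0∞} {h : α → ℝ≥0∞} {C : ℝ≥0∞} (hK : Measurable (Function.uncurry K))
    (hh : Measurable h) (h0 : ∀ᵐ x ∂μ, h x ≠ 0 ∧ h x ≠ ⊤)
    (h₁ : ∀ᵐ x ∂μ, ∫⁻ y, K x y * h y ∂μ ≤ C * h x)
    (h₂ : ∀ᵐ y ∂μ, ∫⁻ x, K x y * h x ∂μ ≤ C * h y) {f : α → ℝ≥0∞} (hf : AEMeasurable f μ) :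
    ∫⁻ x, (∫⁻ y, K x y * f y ∂μ) ^ (2 : ℝ) ∂μ ≤ C ^ (2 : ℝ) * ∫⁻ y, f y ^ (2 : ℝ) ∂μ := by
  wlog hfm : Measurable f generalizing f
  · have hae := hf.ae_eq_mk
    have := this hf.measurable_mk.aemeasurable hf.measurable_mk
    have e1 : ∀ x, ∫⁻ y, K x y * f y ∂μ = ∫⁻ y, K x y * hf.mk f y ∂μ := fun x =>
      lintegral_congr_ae (by filter_upwards [hae] with y hy; rw [hy])
    have e2 : ∫⁻ y, f y ^ (2 : ℝ) ∂μ = ∫⁻ y, hf.mk f y ^ (2 : ℝ) ∂μ :=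
      lintegral_congr_ae (by filter_upwards [hae] with y hy; rw [hy])
    simpa only [e1, e2] using this
  have hKx : ∀ x, Measurable (K x) := fun x => hK.of_uncurry_left
  have hKy : ∀ y, Measurable fun x => K x y := fun y => hK.of_uncurry_right
  have cs : ∀ᵐ x ∂μ, (∫⁻ y, K x y * f y ∂μ) ^ (2 : ℝ) ≤
      ∫⁻ y, C * h x * (K x y * ((h y)⁻¹ * f y ^ (2 : ℝ))) ∂μ := by
    filter_upwards [h₁] with x hx
    -- Cauchy–Schwarz is applied to the splitting K f = (K h)^{1/2} (K h⁻¹ f²)^{1/2}; the first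
    -- factor is then controlled by the row bound.
    have e : ∫⁻ y, K x y * f y ∂μ = ∫⁻ y, ((fun y => (K x y * h y) ^ (1 / 2 : ℝ)) *
        fun y => (K x y * ((h y)⁻¹ * f y ^ (2 : ℝ))) ^ (1 / 2 : ℝ)) y ∂μ := by
      refine lintegral_congr_ae ?_
      filter_upwards [h0] with y hy
      rw [Pi.mul_apply, ← ENNReal.mul_rpow_of_nonneg _ _ (by norm_num)]
      have : K x y * h y * (K x y * ((h y)⁻¹ * f y ^ (2 : ℝ))) = (K x y * f y) ^ (2 : ℝ) := by
        rw [ENNReal.mul_rpow_of_nonneg _ _ (by norm_num)]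
        calc _ = (h y * (h y)⁻¹) * ((K x y * K x y) * f y ^ (2 : ℝ)) := by ring
          _ = _ := by
            rw [ENNReal.mul_inv_cancel hy.1 hy.2, one_mul]
            norm_num [sq]
      rw [this, ← ENNReal.rpow_mul]
      norm_num
    have hol := ENNReal.lintegral_mul_le_Lp_mul_Lq μ Real.HolderConjugate.two_two
      (f := fun y => (K x y * h y) ^ (1 / 2 : ℝ))
      (g := fun y => (K x y * ((h y)⁻¹ * f y ^ (2 : ℝ))) ^ (1 / 2 : ℝ)) (by fun_prop) (by fun_prop)
    rw [← e] at hol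
    simp only [← ENNReal.rpow_mul] at hol
    norm_num at hol
    calc (∫⁻ y, K x y * f y ∂μ) ^ (2 : ℝ)
        ≤ ((∫⁻ y, K x y * h y ∂μ) ^ (1 / 2 : ℝ) *
            (∫⁻ y, K x y * ((h y)⁻¹ * f y ^ (2 : ℝ)) ∂μ) ^ (1 / 2 : ℝ)) ^ (2 : ℝ) := by
          refine ENNReal.rpow_le_rpow ?_ (by norm_num)
          simpa using hol
      _ = (∫⁻ y, K x y * h y ∂μ) * ∫⁻ y, K x y * ((h y)⁻¹ * f y ^ (2 : ℝ)) ∂μ := by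
          rw [ENNReal.mul_rpow_of_nonneg _ _ (by norm_num), ← ENNReal.rpow_mul,
            ← ENNReal.rpow_mul]
          norm_num
      _ ≤ C * h x * ∫⁻ y, K x y * ((h y)⁻¹ * f y ^ (2 : ℝ)) ∂μ := by gcongr
      _ = _ := (lintegral_const_mul _ (by fun_prop)).symm
  calc ∫⁻ x, (∫⁻ y, K x y * f y ∂μ) ^ (2 : ℝ) ∂μ
      ≤ ∫⁻ x, ∫⁻ y, C * h x * (K x y * ((h y)⁻¹ * f y ^ (2 : ℝ))) ∂μ ∂μ := lintegral_mono_ae cs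
    -- Tonelli puts the x-integral inside, where the column bound produces C h(y) and cancels the (h
    -- y)⁻¹.
    _ = ∫⁻ y, ∫⁻ x, C * h x * (K x y * ((h y)⁻¹ * f y ^ (2 : ℝ))) ∂μ ∂μ :=
        lintegral_lintegral_swap (by
          refine Measurable.aemeasurable ?_
          have := hK
          unfold Function.uncurry at this ⊢
          fun_prop)
    _ ≤ ∫⁻ y, C ^ (2 : ℝ) * f y ^ (2 : ℝ) ∂μ := by
        refine lintegral_mono_ae ?_
        filter_upwards [h0, h₂] with y hy hy₂
        calc ∫⁻ x, C * h x * (K x y * ((h y)⁻¹ * f y ^ (2 : ℝ))) ∂μ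
            = ∫⁻ x, C * ((h y)⁻¹ * f y ^ (2 : ℝ)) * (K x y * h x) ∂μ :=
              lintegral_congr fun x => by ring
          _ = C * ((h y)⁻¹ * f y ^ (2 : ℝ)) * ∫⁻ x, K x y * h x ∂μ :=
              lintegral_const_mul _ (by fun_prop)
          _ ≤ C * ((h y)⁻¹ * f y ^ (2 : ℝ)) * (C * h y) := by gcongr
          _ = (h y * (h y)⁻¹) * (C ^ (2 : ℝ) * f y ^ (2 : ℝ)) := by
              norm_num [sq]
              ring
          _ = _ := by rw [ENNReal.mul_inv_cancel hy.1 hy.2, one_mul]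
    _ = _ := lintegral_const_mul _ (by fun_prop)

/-! ### Riesz kernels and their boundedness on L². -/

section RieszKernel

variable {n : ℕ}

local notation "E" => EuclideanSpace ℝ (Fin n)

/-- In polar coordinates the integrand becomes y^{n-1-p} on (0, 1), integrable because p < n. -/
lemma lintegral_ball_enorm_rpow_lt_top (hn : 0 < n) {p : ℝ} (hp : p < n) :
    ∫⁻ x in Metric.ball (0 : E) 1, ‖x‖ₑ ^ (-p) < ⊤ := by
  have : Nonempty (Fin n) := ⟨⟨0, hn⟩⟩
  have h : IntegrableOn (fun x : E => ‖x‖ ^ (-p)) (Metric.ball 0 1) := by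
    rw [integrableOn_fun_norm_addHaar volume (f := fun y => y ^ (-p))]
    have h1 : IntegrableOn (fun y : ℝ => y ^ ((n : ℝ) - 1 - p)) (Set.Ioo 0 1) :=
      (intervalIntegral.integrableOn_Ioo_rpow_iff zero_lt_one).2 (by linarith)
    refine h1.congr_fun (fun y hy => ?_) measurableSet_Ioo
    simp only [finrank_euclideanSpace, Fintype.card_fin, smul_eq_mul]
    rw [← Real.rpow_natCast, ← Real.rpow_add hy.1, Nat.cast_sub hn]
    norm_num [sub_eq_add_neg]
  have h2 := h.2
  rw [HasFiniteIntegral] at h2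
  refine lt_of_le_of_lt (le_of_eq (lintegral_congr_ae ?_)) h2
  have h0 : ∀ᵐ x : E ∂volume.restrict (Metric.ball 0 1), x ≠ 0 :=
    ae_restrict_of_ae (Measure.ae_ne volume 0)
  filter_upwards [h0] with x hx
  rw [← ofReal_norm, ← ofReal_norm, ENNReal.ofReal_rpow_of_pos (by simpa using hx),
    Real.norm_of_nonneg (by positivity)]

/-- Off the half ball 1 + |x| ≤ 3|x|, so (1 + |x|)^{-p} serves as an integrable majorant up to the
factor 3^p. -/
lemma lintegral_compl_ball_enorm_rpow_lt_top {p : ℝ} (hp : n < p) :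
    ∫⁻ x in (Metric.ball (0 : E) (1 / 2))ᶜ, ‖x‖ₑ ^ (-p) < ⊤ := by
  have hp0 : 0 ≤ p := (Nat.cast_nonneg n).trans hp.le
  have h : Integrable (fun x : E => (1 + ‖x‖) ^ (-p)) :=
    integrable_one_add_norm (by simpa using hp)
  have h2 := h.2
  rw [HasFiniteIntegral] at h2
  calc ∫⁻ x in (Metric.ball (0 : E) (1 / 2))ᶜ, ‖x‖ₑ ^ (-p)
      ≤ ∫⁻ x in (Metric.ball (0 : E) (1 / 2))ᶜ, 3 ^ p * ‖(1 + ‖x‖) ^ (-p)‖ₑ := by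
        refine setLIntegral_mono' measurableSet_ball.compl fun x hx => ?_
        have hx' : 1 / 2 ≤ ‖x‖ := by simpa using hx
        have e : ‖(1 + ‖x‖) ^ (-p)‖ₑ = ENNReal.ofReal (1 + ‖x‖) ^ (-p) := by
          rw [ENNReal.ofReal_rpow_of_pos (by positivity), ← ofReal_norm,
            Real.norm_of_nonneg (by positivity)]
        rw [e]
        refine ENNReal.rpow_neg_le_of_le_mul (by norm_num) (by norm_num) hp0 ?_
        rw [← ofReal_norm, ← ENNReal.ofReal_ofNat 3, ← ENNReal.ofReal_mul (by norm_num)]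
        exact ENNReal.ofReal_le_ofReal (by linarith)
    _ ≤ ∫⁻ x : E, 3 ^ p * ‖(1 + ‖x‖) ^ (-p)‖ₑ := setLIntegral_le_lintegral _ _
    _ = 3 ^ p * ∫⁻ x : E, ‖(1 + ‖x‖) ^ (-p)‖ₑ := lintegral_const_mul' _ _
        (ENNReal.rpow_ne_top_of_nonneg hp0 (by norm_num))
    _ < ⊤ := ENNReal.mul_lt_top
        (ENNReal.rpow_ne_top_of_nonneg hp0 (by norm_num)).lt_top h2

lemma lintegral_comp_smul_euclidean {f : E → ℝ≥0∞} (hf : Measurable f) {r : ℝ} (hr : 0 < r) :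
    ∫⁻ x, f x = ENNReal.ofReal r ^ (n : ℝ) * ∫⁻ x, f (r • x) := by
  have h := Measure.map_addHaar_smul (volume : Measure E) hr.ne'
  have h1 : ∫⁻ x, f (r • x) = ∫⁻ y, f y ∂(Measure.map (r • ·) (volume : Measure E)) :=
    (lintegral_map hf (measurable_const_smul r)).symm
  rw [h1, h, lintegral_smul_measure, finrank_euclideanSpace, Fintype.card_fin, smul_eq_mul,
    abs_of_pos (by positivity), ← mul_assoc, ENNReal.rpow_natCast, ← ENNReal.ofReal_pow hr.le,
    ← ENNReal.ofReal_mul (by positivity), mul_inv_cancel₀ (by positivity)]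
  simp

/-- Composition of Riesz kernels on the unit sphere. -/
lemma lintegral_riesz_unit_le (hn : 0 < n) {a b : ℝ} (ha : 0 < a) (hab : a < b) (hb : b < n) :
    ∃ C : ℝ≥0∞, C ≠ ⊤ ∧ ∀ e : E, ‖e‖ = 1 →
      ∫⁻ η, ‖e - η‖ₑ ^ (a - n) * ‖η‖ₑ ^ (-b) ≤ C := by
  set q : ℝ := n - a with hq
  have hq0 : 0 ≤ q := by linarith
  have hb0 : 0 ≤ b := by linarith
  -- These majorize the integrand near 0, near e (after the translation η ↦ e - η), and away from
  -- both points. Their integrability uses b < n, a > 0 and a < b respectively.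
  set Φ₁ : E → ℝ≥0∞ := (Metric.ball (0 : E) 1).indicator fun x => 2 ^ q * ‖x‖ₑ ^ (-b)
  set Φ₂ : E → ℝ≥0∞ := (Metric.ball (0 : E) 1).indicator fun x => 2 ^ b * ‖x‖ₑ ^ (-q)
  set Φ₃ : E → ℝ≥0∞ :=
    (Metric.ball (0 : E) (1 / 2))ᶜ.indicator fun x => 3 ^ q * ‖x‖ₑ ^ (-(q + b))
  have h2 : ∀ r : ℝ, 0 ≤ r → (2 : ℝ≥0∞) ^ r ≠ ⊤ := fun r hr =>
    ENNReal.rpow_ne_top_of_nonneg hr (by norm_num)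
  have h3 : (3 : ℝ≥0∞) ^ q ≠ ⊤ := ENNReal.rpow_ne_top_of_nonneg hq0 (by norm_num)
  have m₁ : Measurable Φ₁ := by
    refine Measurable.indicator ?_ measurableSet_ball
    fun_prop
  have m₂ : Measurable Φ₂ := by
    refine Measurable.indicator ?_ measurableSet_ball
    fun_prop
  refine ⟨(∫⁻ x, Φ₁ x) + (∫⁻ x, Φ₂ x) + ∫⁻ x, Φ₃ x, ?_, fun e he => ?_⟩
  · have i₁ : ∫⁻ x, Φ₁ x ≠ ⊤ := by
      rw [lintegral_indicator measurableSet_ball, lintegral_const_mul' _ _ (h2 q hq0)]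
      exact ENNReal.mul_ne_top (h2 q hq0) (lintegral_ball_enorm_rpow_lt_top hn hb).ne
    have i₂ : ∫⁻ x, Φ₂ x ≠ ⊤ := by
      rw [lintegral_indicator measurableSet_ball, lintegral_const_mul' _ _ (h2 b hb0)]
      exact ENNReal.mul_ne_top (h2 b hb0) (lintegral_ball_enorm_rpow_lt_top hn (by linarith)).ne
    have i₃ : ∫⁻ x, Φ₃ x ≠ ⊤ := by
      rw [lintegral_indicator measurableSet_ball.compl, lintegral_const_mul' _ _ h3]
      exact ENNReal.mul_ne_top h3 (lintegral_compl_ball_enorm_rpow_lt_top (by linarith)).ne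
    exact ENNReal.add_ne_top.2 ⟨ENNReal.add_ne_top.2 ⟨i₁, i₂⟩, i₃⟩
  · have t₂ : ∫⁻ x, Φ₂ x = ∫⁻ x, Φ₂ (e - x) := (lintegral_sub_left_eq_self _ e).symm
    rw [t₂, ← lintegral_add_left m₁, ← lintegral_add_left (by fun_prop)]
    refine lintegral_mono fun η => ?_
    have ha' : a - n = -q := by rw [hq]; ring
    rw [ha']
    have tri : 1 ≤ ‖e - η‖ + ‖η‖ := by
      rw [← he]; simpa using norm_add_le (e - η) η
    have key : ∀ {c : ℝ} {x y : E}, 0 < c → ‖y‖ ≤ c * ‖x‖ → ‖y‖ₑ ≤ ENNReal.ofReal c * ‖x‖ₑ := by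
      intro c x y hc h
      rw [← ofReal_norm, ← ofReal_norm, ← ENNReal.ofReal_mul hc.le]
      exact ENNReal.ofReal_le_ofReal h
    have key1 : ∀ {x : E} {r : ℝ}, 0 ≤ r → 1 / 2 ≤ ‖x‖ → ‖x‖ₑ ^ (-r) ≤ 2 ^ r := by
      intro x r hr h
      have := ENNReal.rpow_neg_le_of_le_mul (c := 2) (x := ‖x‖ₑ) (y := 1) (by norm_num)
        (by norm_num) hr (by
          have := key (c := 2) (x := x) (y := e) (by norm_num) (by rw [he]; linarith)
          rwa [← ofReal_norm e, he, ENNReal.ofReal_one, ENNReal.ofReal_ofNat] at this)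
      simpa using this
    rcases lt_or_ge ‖η‖ (1 / 2) with h | h
    · have : Φ₁ η = 2 ^ q * ‖η‖ₑ ^ (-b) := Set.indicator_of_mem (by simp; linarith) _
      calc ‖e - η‖ₑ ^ (-q) * ‖η‖ₑ ^ (-b) ≤ 2 ^ q * ‖η‖ₑ ^ (-b) := by
            gcongr
            exact key1 hq0 (by linarith)
        _ = Φ₁ η := this.symm
        _ ≤ _ := by rw [add_assoc]; exact le_self_add
    · rcases lt_or_ge ‖e - η‖ (1 / 2) with h' | h'
      · have : Φ₂ (e - η) = 2 ^ b * ‖e - η‖ₑ ^ (-q) :=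
          Set.indicator_of_mem (by rw [mem_ball_zero_iff]; linarith) _
        calc ‖e - η‖ₑ ^ (-q) * ‖η‖ₑ ^ (-b) ≤ ‖e - η‖ₑ ^ (-q) * 2 ^ b := by
              gcongr
              exact key1 hb0 h
          _ = Φ₂ (e - η) := by rw [this, mul_comm]
          _ ≤ _ := le_add_right le_add_self
      · have : Φ₃ η = 3 ^ q * ‖η‖ₑ ^ (-(q + b)) := Set.indicator_of_mem (by simpa using h) _
        have hη : ‖η‖ ≤ 3 * ‖e - η‖ := by
          have : ‖η‖ ≤ ‖e - η‖ + ‖e‖ := by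
            have := norm_sub_le e (e - η)
            rw [sub_sub_cancel] at this
            linarith
          rw [he] at this
          linarith
        have hk := key (by norm_num) hη
        rw [ENNReal.ofReal_ofNat] at hk
        calc ‖e - η‖ₑ ^ (-q) * ‖η‖ₑ ^ (-b) ≤ 3 ^ q * ‖η‖ₑ ^ (-q) * ‖η‖ₑ ^ (-b) := by
              gcongr
              exact ENNReal.rpow_neg_le_of_le_mul (by norm_num) (by norm_num) hq0 hk
          _ = Φ₃ η := by
              rw [this, mul_assoc, neg_add, ← ENNReal.rpow_add _ _ _ enorm_ne_top]
              rw [enorm_ne_zero]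
              rintro rfl
              norm_num at h
          _ ≤ _ := le_add_self

/-- Composition of Riesz kernels. -/
lemma lintegral_riesz_le (hn : 0 < n) {a b : ℝ} (ha : 0 < a) (hab : a < b) (hb : b < n) :
    ∃ C : ℝ≥0∞, C ≠ ⊤ ∧ ∀ ξ : E, ξ ≠ 0 →
      ∫⁻ η, ‖ξ - η‖ₑ ^ (a - n) * ‖η‖ₑ ^ (-b) ≤ C * ‖ξ‖ₑ ^ (a - b) := by
  obtain ⟨C, hC, h⟩ := lintegral_riesz_unit_le hn ha hab hb
  refine ⟨C, hC, fun ξ hξ => ?_⟩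
  have hr : 0 < ‖ξ‖ := norm_pos_iff.2 hξ
  have h0 : ‖ξ‖ₑ ≠ 0 := enorm_ne_zero.2 hξ
  -- Dilation by |ξ| reduces to the unit sphere; the total homogeneity is n + (a - n) - b = a - b.
  rw [lintegral_comp_smul_euclidean (by fun_prop) hr]
  set e : E := ‖ξ‖⁻¹ • ξ with he
  have hξe : ξ = ‖ξ‖ • e := by rw [he, smul_inv_smul₀ hr.ne']
  have hs : ∀ η : E, ‖ξ - ‖ξ‖ • η‖ₑ ^ (a - n) * ‖‖ξ‖ • η‖ₑ ^ (-b) =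
      ‖ξ‖ₑ ^ (a - n - b) * (‖e - η‖ₑ ^ (a - n) * ‖η‖ₑ ^ (-b)) := by
    intro η
    have e1 : ξ - ‖ξ‖ • η = ‖ξ‖ • (e - η) := by rw [smul_sub, ← hξe]
    rw [e1, enorm_smul, enorm_smul, enorm_norm, 
      ENNReal.mul_rpow_of_ne_top enorm_ne_top enorm_ne_top,
      ENNReal.mul_rpow_of_ne_top enorm_ne_top enorm_ne_top,
      sub_eq_add_neg _ b, ENNReal.rpow_add _ _ h0 enorm_ne_top]
    ring
  simp_rw [hs]
  rw [lintegral_const_mul _ (by fun_prop), ofReal_norm, ← mul_assoc,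
    ← ENNReal.rpow_add _ _ h0 enorm_ne_top, mul_comm]
  have : (n : ℝ) + (a - n - b) = a - b := by ring
  rw [this]
  gcongr
  exact h e (by rw [he, norm_smul, norm_inv, norm_norm, inv_mul_cancel₀ hr.ne'])

/-- The kernel `|ξ - η|^(a - n) |η|^(-a)` defines a bounded operator on `L²` if `0 < a < n / 2`. -/
lemma eLpNorm_riesz_mul_rpow_le {a : ℝ} (ha : 0 < a) (han : a < n / 2) :
    ∃ C : ℝ≥0∞, C ≠ ⊤ ∧ ∀ f : E → ℝ≥0∞, AEMeasurable f →
      eLpNorm (fun ξ => ∫⁻ η, ‖ξ - η‖ₑ ^ (a - n) * (‖η‖ₑ ^ (-a) * f η)) 2 volume ≤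
        C * eLpNorm f 2 volume := by
  have hn' : (0 : ℝ) < n := by linarith
  have hn : 0 < n := by exact_mod_cast hn'
  -- The Schur weight is |ξ|^{-n/2}. Integration in η requires a + n/2 < n and integration in ξ
  -- requires a < n/2, which is the same condition.
  obtain ⟨C₁, hC₁, h₁⟩ := lintegral_riesz_le hn ha (b := a + n / 2) (by linarith) (by linarith)
  obtain ⟨C₂, hC₂, h₂⟩ := lintegral_riesz_le hn ha (b := n / 2) (by linarith) (by linarith)
  have h0 : ∀ᵐ x : E, x ≠ 0 := by
    have : Nonempty (Fin n) := ⟨⟨0, hn⟩⟩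
    exact Measure.ae_ne volume 0
  refine ⟨max C₁ C₂, by simp [hC₁, hC₂], fun f hf => ?_⟩
  have hs := lintegral_sq_le_of_schur (μ := (volume : Measure E))
    (K := fun ξ η => ‖ξ - η‖ₑ ^ (a - n) * ‖η‖ₑ ^ (-a)) (h := fun ξ => ‖ξ‖ₑ ^ (-(n / 2 : ℝ)))
    (C := max C₁ C₂) (by unfold Function.uncurry; fun_prop) (by fun_prop) ?_ ?_ ?_ hf
  · rw [eLpNorm_eq_lintegral_rpow_enorm_toReal (by norm_num) (by norm_num),
      eLpNorm_eq_lintegral_rpow_enorm_toReal (by norm_num) (by norm_num)]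
    simp only [enorm_eq_self, ENNReal.toReal_ofNat]
    have e : max C₁ C₂ = ((max C₁ C₂) ^ (2 : ℝ)) ^ (1 / 2 : ℝ) := by
      rw [← ENNReal.rpow_mul]; norm_num
    rw [e, ← ENNReal.mul_rpow_of_nonneg _ _ (by norm_num)]
    refine ENNReal.rpow_le_rpow ?_ (by norm_num)
    simpa only [mul_assoc] using hs
  · filter_upwards [h0] with x hx
    simp [ENNReal.rpow_eq_zero_iff, ENNReal.rpow_eq_top_iff, hx]
  · filter_upwards [h0] with ξ hξ
    calc ∫⁻ η, ‖ξ - η‖ₑ ^ (a - n) * ‖η‖ₑ ^ (-a) * ‖η‖ₑ ^ (-(n / 2 : ℝ))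
        = ∫⁻ η, ‖ξ - η‖ₑ ^ (a - n) * ‖η‖ₑ ^ (-(a + n / 2)) := by
          refine lintegral_congr_ae ?_
          filter_upwards [h0] with η hη
          rw [mul_assoc, ← ENNReal.rpow_add _ _ (enorm_ne_zero.2 hη) enorm_ne_top, neg_add]
      _ ≤ C₁ * ‖ξ‖ₑ ^ (a - (a + n / 2)) := h₁ ξ hξ
      _ ≤ max C₁ C₂ * ‖ξ‖ₑ ^ (-(n / 2 : ℝ)) := by
          rw [sub_add_cancel_left]
          gcongr
          exact le_max_left _ _
  · filter_upwards [h0] with η hη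
    calc ∫⁻ ξ, ‖ξ - η‖ₑ ^ (a - n) * ‖η‖ₑ ^ (-a) * ‖ξ‖ₑ ^ (-(n / 2 : ℝ))
        = ∫⁻ ξ, ‖η‖ₑ ^ (-a) * (‖η - ξ‖ₑ ^ (a - n) * ‖ξ‖ₑ ^ (-(n / 2 : ℝ))) := by
          refine lintegral_congr fun ξ => ?_
          rw [enorm_sub_rev]
          ring
      _ = ‖η‖ₑ ^ (-a) * ∫⁻ ξ, ‖η - ξ‖ₑ ^ (a - n) * ‖ξ‖ₑ ^ (-(n / 2 : ℝ)) :=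
          lintegral_const_mul _ (by fun_prop)
      _ ≤ ‖η‖ₑ ^ (-a) * (C₂ * ‖η‖ₑ ^ (a - n / 2)) := by
          gcongr
          exact h₂ η hη
      _ = C₂ * ‖η‖ₑ ^ (-(n / 2 : ℝ)) := by
          rw [mul_left_comm, ← ENNReal.rpow_add _ _ (enorm_ne_zero.2 hη) enorm_ne_top]
          ring_nf
      _ ≤ max C₁ C₂ * ‖η‖ₑ ^ (-(n / 2 : ℝ)) := by
          gcongr
          exact le_max_right _ _

end RieszKernel

lemma eLpNorm_two_const_mul_ennreal {α : Type*} [MeasurableSpace α] {μ : Measure α} {c : ℝ≥0∞}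
    {f : α → ℝ≥0∞} (hf : AEMeasurable f μ) :
    eLpNorm (fun x => c * f x) 2 μ = c * eLpNorm f 2 μ := by
  rw [eLpNorm_eq_lintegral_rpow_enorm_toReal (by norm_num) (by norm_num),
    eLpNorm_eq_lintegral_rpow_enorm_toReal (by norm_num) (by norm_num)]
  simp only [enorm_eq_self, ENNReal.toReal_ofNat, ENNReal.mul_rpow_of_nonneg _ _ zero_le_two]
  rw [lintegral_const_mul'' _ (hf.pow_const _), ENNReal.mul_rpow_of_nonneg _ _ (by norm_num),
    ← ENNReal.rpow_mul]
  norm_num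

/-! ### Products in homogeneous Sobolev spaces via convolution. -/

section FourierProduct

variable {n : ℕ}

local notation "E" => EuclideanSpace ℝ (Fin n)

/-- The convolution of Schwartz functions unfolds to the inverse transform of the product of
transforms. Applied to 𝓕φ and 𝓕u this involves 𝓕𝓕f = f(-·), and the reflection is undone by writing
𝓕⁻ as 𝓕 after x ↦ -x. -/
lemma SchwartzMap.fourier_mul_eq_convolution (φ u : 𝓢(E, ℂ)) (ξ : E) :
    𝓕 (fun x => φ x * u x) ξ = ∫ η, 𝓕 φ (ξ - η) * 𝓕 u η := by
  have h := SchwartzMap.convolution_apply (ContinuousLinearMap.mul ℂ ℂ) (𝓕 φ) (𝓕 u) ξ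
  rw [convolution_eq_swap] at h
  simp only [ContinuousLinearMap.mul_apply'] at h
  rw [← h]
  have hneg : ∀ (f : 𝓢(E, ℂ)) (y : E), 𝓕 (𝓕 f) y = f (-y) := by
    intro f y
    have h1 : 𝓕⁻ (𝓕 f) (-y) = f (-y) := by simp
    rw [← h1, SchwartzMap.fourierInv_coe, SchwartzMap.fourier_coe,
      Real.fourierInv_eq_fourier_neg, neg_neg]
  change _ = 𝓕⁻ (SchwartzMap.pairing (ContinuousLinearMap.mul ℂ ℂ) (𝓕 (𝓕 φ)) (𝓕 (𝓕 u))) ξ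
  rw [SchwartzMap.fourierInv_coe, Real.fourierInv_eq_fourier_comp_neg]
  refine congrArg (fun f : E → ℂ => 𝓕 f ξ) (funext fun x => ?_)
  rw [SchwartzMap.pairing_apply_apply, hneg, hneg]
  simp

lemma exists_enorm_fourierT_mul_le : ∃ C : ℝ≥0∞, C ≠ ⊤ ∧
    ∀ (φ u : 𝓢(E, ℂ)) (ξ : E), ‖fourierT (fun x => φ x * u x) ξ‖ₑ ≤
      C * ∫⁻ η, ‖fourierT φ (ξ - η)‖ₑ * ‖fourierT u η‖ₑ := by
  set c : ℂ := (((2 * Real.pi) ^ (-(n : ℝ) / 2) : ℝ) : ℂ) with hc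
  have hc0 : c ≠ 0 := by
    rw [hc, Ne, Complex.ofReal_eq_zero]
    positivity
  set r : ℝ := (2 * Real.pi)⁻¹ with hr
  have hr0 : 0 < r := by positivity
  refine ⟨‖c‖ₑ * (ENNReal.ofReal r ^ (n : ℝ) * (‖c⁻¹‖ₑ * ‖c⁻¹‖ₑ)), ?_, fun φ u ξ => ?_⟩
  · refine ENNReal.mul_ne_top enorm_ne_top (ENNReal.mul_ne_top ?_
      (ENNReal.mul_ne_top enorm_ne_top enorm_ne_top))
    exact ENNReal.rpow_ne_top_of_nonneg (Nat.cast_nonneg n) ENNReal.ofReal_ne_top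
  · have hF : ∀ (f : 𝓢(E, ℂ)) (η : E), 𝓕 f (r • η) = c⁻¹ * fourierT f η := by
      intro f η
      rw [fourierT_eq, ← hc, ← hr, inv_mul_cancel_left₀ hc0]
    have h1 : fourierT (fun x => φ x * u x) ξ = c * 𝓕 (fun x => φ x * u x) (r • ξ) :=
      fourierT_eq (SchwartzMap.pairing (ContinuousLinearMap.mul ℂ ℂ) φ u) ξ
    rw [h1, SchwartzMap.fourier_mul_eq_convolution, enorm_mul, mul_assoc]
    gcongr
    refine (enorm_integral_le_lintegral_enorm _).trans ?_
    rw [lintegral_comp_smul_euclidean (by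
      have := (𝓕 φ).continuous
      have := (𝓕 u).continuous
      fun_prop) hr0, mul_assoc]
    gcongr ENNReal.ofReal r ^ (n : ℝ) * ?_
    rw [← lintegral_const_mul' _ _ (ENNReal.mul_ne_top enorm_ne_top enorm_ne_top)]
    refine lintegral_mono fun η => ?_
    rw [← smul_sub, hF, hF, enorm_mul, enorm_mul, enorm_mul]
    apply le_of_eq
    ring

/-- The homogeneous Sobolev norm `‖|·|ᵗ 𝓕f‖_{L²}`. -/
noncomputable def hsobENorm (t : ℝ) (f : E → ℂ) : ℝ≥0∞ :=
  eLpNorm (fun ξ => ((‖ξ‖ ^ t : ℝ) : ℂ) * fourierT f ξ) 2 volume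

lemma enorm_rpow_mul {t : ℝ} (ht : 0 ≤ t) (ξ : E) (z : ℂ) :
    ‖((‖ξ‖ ^ t : ℝ) : ℂ) * z‖ₑ = ‖ξ‖ₑ ^ t * ‖z‖ₑ := by
  rw [enorm_mul, ← ofReal_norm (((‖ξ‖ ^ t : ℝ) : ℂ)), Complex.norm_real, ofReal_norm,
    Real.enorm_rpow_of_nonneg (norm_nonneg _) ht, enorm_norm]

lemma hsobENorm_eq {t : ℝ} (ht : 0 ≤ t) (f : E → ℂ) :
    hsobENorm t f = eLpNorm (fun ξ => ‖ξ‖ₑ ^ t * ‖fourierT f ξ‖ₑ) 2 volume := by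
  refine eLpNorm_congr_enorm_ae (Filter.Eventually.of_forall fun ξ => ?_)
  rw [enorm_rpow_mul ht, enorm_eq_self]

lemma SchwartzMap.continuous_fourierT (f : 𝓢(E, ℂ)) : Continuous (fourierT f) := by
  have : fourierT f = fun ξ => (((2 * Real.pi) ^ (-(n : ℝ) / 2) : ℝ) : ℂ) *
      (𝓕 f) ((2 * Real.pi)⁻¹ • ξ) := funext (fourierT_eq f)
  rw [this]
  have := (𝓕 f).continuous
  fun_prop

/-- Multiplication by a Schwartz function between homogeneous Sobolev spaces, with constants
depending only on weighted sup norms of its Fourier transform. -/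
lemma exists_hsobENorm_mul_le {t a b : ℝ} (ht : 0 ≤ t) (ha : 0 < a) (han : a < n / 2) (hb : 0 < b)
    (hbn : b < n / 2) : ∃ C : ℝ≥0∞, C ≠ ⊤ ∧ ∀ (φ u : 𝓢(E, ℂ)) (A B : ℝ≥0∞),
      (∀ ζ : E, ‖ζ‖ₑ ^ (t + n - a) * ‖fourierT φ ζ‖ₑ ≤ A) →
      (∀ ζ : E, ‖ζ‖ₑ ^ (n - b) * ‖fourierT φ ζ‖ₑ ≤ B) →
      hsobENorm t (fun x => φ x * u x) ≤ C * (A * hsobENorm a u + B * hsobENorm (t + b) u) := by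
  have hn' : (0 : ℝ) < n := by linarith
  have hn : 0 < n := by exact_mod_cast hn'
  have : Nonempty (Fin n) := ⟨⟨0, hn⟩⟩
  obtain ⟨c, hc, hmul⟩ := exists_enorm_fourierT_mul_le (n := n)
  obtain ⟨Ca, hCa, hKa⟩ := eLpNorm_riesz_mul_rpow_le (n := n) ha han
  obtain ⟨Cb, hCb, hKb⟩ := eLpNorm_riesz_mul_rpow_le (n := n) hb hbn
  have h2t : (2 : ℝ≥0∞) ^ t ≠ ⊤ := ENNReal.rpow_ne_top_of_nonneg ht (by norm_num)
  refine ⟨c * 2 ^ t * (Ca + Cb), ENNReal.mul_ne_top (ENNReal.mul_ne_top hc h2t)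
    (ENNReal.add_ne_top.2 ⟨hCa, hCb⟩), fun φ u A B hA hB => ?_⟩
  have mφ := φ.continuous_fourierT.measurable
  have mu := u.continuous_fourierT.measurable
  set Fa : E → ℝ≥0∞ := fun η => ‖η‖ₑ ^ a * ‖fourierT u η‖ₑ with hFa
  set Fb : E → ℝ≥0∞ := fun η => ‖η‖ₑ ^ (t + b) * ‖fourierT u η‖ₑ with hFb
  have mFa : Measurable Fa := by fun_prop
  have mFb : Measurable Fb := by fun_prop
  set I : ℝ → (E → ℝ≥0∞) → E → ℝ≥0∞ := fun a f ξ =>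
    ∫⁻ η, ‖ξ - η‖ₑ ^ (a - n) * (‖η‖ₑ ^ (-a) * f η) with hI
  have mI : ∀ a f, Measurable f → Measurable (I a f) := by
    intro a f hf
    refine Measurable.lintegral_prod_right' (f := fun p : E × E =>
      ‖p.1 - p.2‖ₑ ^ (a - n) * (‖p.2‖ₑ ^ (-a) * f p.2)) ?_
    fun_prop
  have hpt : ∀ ξ : E, ‖ξ‖ₑ ^ t * ‖fourierT (fun x => φ x * u x) ξ‖ₑ ≤
      c * 2 ^ t * (A * I a Fa ξ + B * I b Fb ξ) := by
    intro ξ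
    calc ‖ξ‖ₑ ^ t * ‖fourierT (fun x => φ x * u x) ξ‖ₑ
        ≤ ‖ξ‖ₑ ^ t * (c * ∫⁻ η, ‖fourierT φ (ξ - η)‖ₑ * ‖fourierT u η‖ₑ) := by
          gcongr
          exact hmul φ u ξ
      _ = c * ∫⁻ η, ‖ξ‖ₑ ^ t * (‖fourierT φ (ξ - η)‖ₑ * ‖fourierT u η‖ₑ) := by
          rw [lintegral_const_mul' _ _ (ENNReal.rpow_ne_top_of_nonneg ht enorm_ne_top)]
          ring
      _ ≤ c * ∫⁻ η, 2 ^ t * (A * (‖ξ - η‖ₑ ^ (a - n) * (‖η‖ₑ ^ (-a) * Fa η)) +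
            B * (‖ξ - η‖ₑ ^ (b - n) * (‖η‖ₑ ^ (-b) * Fb η))) := by
          gcongr c * ?_
          refine lintegral_mono_ae ?_
          filter_upwards [Measure.ae_ne volume 0, Measure.ae_ne volume ξ] with η h0 hξ
          have hη0 : ‖η‖ₑ ≠ 0 := enorm_ne_zero.2 h0
          have hζ0 : ‖ξ - η‖ₑ ≠ 0 := enorm_ne_zero.2 (sub_ne_zero.2 hξ.symm)
          -- The weight is shared between the two factors: on φ̂ it is paid for by the bound A, on û
          -- by the norm of order t + b.
          have hsplit : ‖ξ‖ₑ ^ t ≤ 2 ^ t * (‖ξ - η‖ₑ ^ t + ‖η‖ₑ ^ t) := by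
            refine le_trans ?_ (ENNReal.add_rpow_le_two_rpow_mul_rpow_add_rpow _ _ ht)
            gcongr
            simpa using enorm_add_le (ξ - η) η
          -- The exponents in the hypotheses on φ̂ are chosen so that exactly a Riesz kernel of
          -- order a, respectively b, remains.
          have hA' : ‖ξ - η‖ₑ ^ t * ‖fourierT φ (ξ - η)‖ₑ ≤ A * ‖ξ - η‖ₑ ^ (a - n) := by
            have : t = (t + n - a) + (a - n) := by ring
            calc _ = (‖ξ - η‖ₑ ^ (t + n - a) * ‖fourierT φ (ξ - η)‖ₑ) * ‖ξ - η‖ₑ ^ (a - n) := by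
                  conv_lhs => rw [this, ENNReal.rpow_add _ _ hζ0 enorm_ne_top]
                  ring
              _ ≤ _ := by gcongr; exact hA _
          have hB' : ‖fourierT φ (ξ - η)‖ₑ ≤ B * ‖ξ - η‖ₑ ^ (b - n) := by
            calc _ = (‖ξ - η‖ₑ ^ (n - b) * ‖fourierT φ (ξ - η)‖ₑ) * ‖ξ - η‖ₑ ^ (b - n) := by
                  rw [mul_right_comm, ← ENNReal.rpow_add _ _ hζ0 enorm_ne_top]
                  simp
              _ ≤ _ := by gcongr; exact hB _
          have eFa : ‖η‖ₑ ^ (-a) * Fa η = ‖fourierT u η‖ₑ := by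
            rw [hFa, ← mul_assoc, ← ENNReal.rpow_add _ _ hη0 enorm_ne_top]
            simp
          have eFb : ‖η‖ₑ ^ (-b) * Fb η = ‖η‖ₑ ^ t * ‖fourierT u η‖ₑ := by
            rw [hFb, ← mul_assoc, ← ENNReal.rpow_add _ _ hη0 enorm_ne_top]
            congr 2
            ring
          rw [eFa, eFb]
          calc _ ≤ 2 ^ t * (‖ξ - η‖ₑ ^ t + ‖η‖ₑ ^ t) *
                (‖fourierT φ (ξ - η)‖ₑ * ‖fourierT u η‖ₑ) := by gcongr
            _ = 2 ^ t * ((‖ξ - η‖ₑ ^ t * ‖fourierT φ (ξ - η)‖ₑ) * ‖fourierT u η‖ₑ +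
                ‖fourierT φ (ξ - η)‖ₑ * (‖η‖ₑ ^ t * ‖fourierT u η‖ₑ)) := by ring
            _ ≤ 2 ^ t * ((A * ‖ξ - η‖ₑ ^ (a - n)) * ‖fourierT u η‖ₑ +
                (B * ‖ξ - η‖ₑ ^ (b - n)) * (‖η‖ₑ ^ t * ‖fourierT u η‖ₑ)) := by gcongr
            _ = _ := by ring
      _ = c * 2 ^ t * (A * I a Fa ξ + B * I b Fb ξ) := by
          rw [lintegral_const_mul' _ _ h2t, lintegral_add_left (by fun_prop),
            lintegral_const_mul _ (by fun_prop), lintegral_const_mul _ (by fun_prop)]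
          ring
  rw [hsobENorm_eq ht, hsobENorm_eq ha.le, hsobENorm_eq (by positivity)]
  calc eLpNorm (fun ξ => ‖ξ‖ₑ ^ t * ‖fourierT (fun x => φ x * u x) ξ‖ₑ) 2 volume
      ≤ eLpNorm (fun ξ => c * 2 ^ t * (A * I a Fa ξ + B * I b Fb ξ)) 2 volume :=
        eLpNorm_mono_enorm fun ξ => by simpa using hpt ξ
    _ = c * 2 ^ t * eLpNorm (fun ξ => A * I a Fa ξ + B * I b Fb ξ) 2 volume :=
        eLpNorm_two_const_mul_ennreal
          (((mI a Fa mFa).const_mul A).add ((mI b Fb mFb).const_mul B)).aemeasurable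
    _ ≤ c * 2 ^ t * (eLpNorm (fun ξ => A * I a Fa ξ) 2 volume +
          eLpNorm (fun ξ => B * I b Fb ξ) 2 volume) := by
        gcongr
        exact eLpNorm_add_le ((mI a Fa mFa).const_mul A).aestronglyMeasurable
          ((mI b Fb mFb).const_mul B).aestronglyMeasurable (by norm_num)
    _ = c * 2 ^ t * (A * eLpNorm (I a Fa) 2 volume + B * eLpNorm (I b Fb) 2 volume) := by
        rw [eLpNorm_two_const_mul_ennreal (mI a Fa mFa).aemeasurable,
          eLpNorm_two_const_mul_ennreal (mI b Fb mFb).aemeasurable]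
    _ ≤ c * 2 ^ t * (A * (Ca * eLpNorm Fa 2 volume) + B * (Cb * eLpNorm Fb 2 volume)) := by
        gcongr
        · exact hKa Fa mFa.aemeasurable
        · exact hKb Fb mFb.aemeasurable
    _ ≤ c * 2 ^ t * (A * ((Ca + Cb) * eLpNorm Fa 2 volume) +
          B * ((Ca + Cb) * eLpNorm Fb 2 volume)) := by
        gcongr
        · exact le_self_add
        · exact le_add_self
    _ = _ := by ring

end FourierProduct

/-! ### Fourier decay from derivatives, cutoffs, and symbols of order -2. -/

section SymbolDecay

variable {n : ℕ}

local notation "E" => EuclideanSpace ℝ (Fin n)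

lemma SchwartzMap.integrable_iteratedFDeriv (φ : 𝓢(E, ℂ)) (m : ℕ) :
    Integrable (iteratedFDeriv ℝ m φ) := by
  have h := φ.integrable_pow_mul_iteratedFDeriv volume 0 m
  simp only [pow_zero, one_mul] at h
  have : SecondCountableTopologyEither E (E [×m]→L[ℝ] ℂ) :=
    secondCountableTopologyEither_of_left _ _
  exact (integrable_norm_iff
    ((φ.smooth ⊤).continuous_iteratedFDeriv (by exact_mod_cast le_top)).aestronglyMeasurable).1 h

/-- The transform of the m-th derivative at w is a multilinear form of norm at most the right side.
Evaluated at (w, …, w) it has modulus (2π)^m |w|^{2m} |φ̂(w)|, and |w|^m is divided out. -/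
lemma SchwartzMap.pow_mul_norm_fourier_le (φ : 𝓢(E, ℂ)) (m : ℕ) (w : E) :
    (2 * Real.pi * ‖w‖) ^ m * ‖𝓕 φ w‖ ≤ ∫ x, ‖iteratedFDeriv ℝ m φ x‖ := by
  have h := congrFun (Real.fourier_iteratedFDeriv (N := ⊤) (φ.smooth ⊤)
    (fun k _ => φ.integrable_iteratedFDeriv k) (n := m) le_top) w
  have h1 : ‖𝓕 (iteratedFDeriv ℝ m φ) w‖ ≤ ∫ x, ‖iteratedFDeriv ℝ m φ x‖ :=
    VectorFourier.norm_fourierIntegral_le_integral_norm _ _ _ _ _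
  -- The division by |w|^m fails at the origin, where only m = 0 carries any content.
  rcases eq_or_ne w 0 with rfl | hw
  · rcases Nat.eq_zero_or_pos m with rfl | hm
    · have h0 : ‖𝓕 (φ : E → ℂ) 0‖ ≤ ∫ x, ‖φ x‖ :=
        VectorFourier.norm_fourierIntegral_le_integral_norm _ _ _ _ _
      simpa [SchwartzMap.fourier_coe] using h0
    · simp [hm.ne']
      positivity
  · rw [h] at h1
    have hT : ∀ (T : E [×m]→L[ℝ] ℂ) (M : ℝ), ‖T‖ ≤ M → ‖T fun _ => w‖ ≤ M * ‖w‖ ^ m := by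
      intro T M hT
      have := (T.le_opNorm fun _ => w).trans
        (mul_le_mul_of_nonneg_right hT (Finset.prod_nonneg fun _ _ => norm_nonneg _))
      simpa using this
    have h2 := hT _ _ h1
    rw [VectorFourier.fourierPowSMulRight_apply] at h2
    simp only [neg_apply, Finset.prod_const, Finset.card_univ,
      Fintype.card_fin, norm_smul, norm_pow, norm_neg, norm_mul, Complex.norm_ofNat,
      Complex.norm_real, Complex.norm_I, mul_one, Real.norm_of_nonneg Real.pi_pos.le] at h2
    have hin : ‖innerSL ℝ w w‖ = ‖w‖ ^ 2 := by
      change ‖inner ℝ w w‖ = _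
      rw [real_inner_self_eq_norm_sq, norm_pow, norm_norm]
    rw [hin] at h2
    have hw' : 0 < ‖w‖ ^ m := by positivity
    rw [← SchwartzMap.fourier_coe] at h2
    refine le_of_mul_le_mul_right (le_trans (le_of_eq ?_) h2) hw'
    rw [mul_pow _ ‖w‖]
    ring

lemma exists_pow_mul_norm_fourierT_le : ∃ C : ℝ, 0 ≤ C ∧ ∀ (φ : 𝓢(E, ℂ)) (m : ℕ) (ζ : E),
    ‖ζ‖ ^ m * ‖fourierT φ ζ‖ ≤ C * ∫ x, ‖iteratedFDeriv ℝ m φ x‖ := by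
  refine ⟨(2 * Real.pi) ^ (-(n : ℝ) / 2), by positivity, fun φ m ζ => ?_⟩
  have h := φ.pow_mul_norm_fourier_le m ((2 * Real.pi)⁻¹ • ζ)
  rw [norm_smul, norm_inv, Real.norm_of_nonneg (by positivity : 0 ≤ 2 * Real.pi),
    mul_inv_cancel_left₀ (by positivity)] at h
  rw [fourierT_eq, norm_mul, Complex.norm_real, Real.norm_of_nonneg (by positivity),
    mul_left_comm]
  gcongr

/-- The lower exponent wins for x ≤ 1 and the higher one for x ≥ 1. This turns fractional Fourier
weights into integer numbers of derivatives, none below order k. -/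
lemma ENNReal.rpow_le_pow_add_pow_ceil (x : ℝ≥0∞) {k : ℕ} {p : ℝ} (hp : k ≤ p) :
    x ^ p ≤ x ^ k + x ^ ⌈p⌉₊ := by
  rcases le_total x 1 with h | h
  · refine le_add_right ?_
    rw [← ENNReal.rpow_natCast]
    exact ENNReal.rpow_le_rpow_of_exponent_ge h hp
  · refine le_add_left ?_
    rw [← ENNReal.rpow_natCast]
    exact ENNReal.rpow_le_rpow_of_exponent_le h (Nat.le_ceil p)

/-- Multiplication by a Schwartz function, with constants depending only on `L¹` norms of its
derivatives of order at least `k`. -/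
lemma exists_hsobENorm_mul_le_of_integral {t a b : ℝ} {k : ℕ} (ht : 0 ≤ t) (ha : 0 < a)
    (han : a < n / 2) (hb : 0 < b) (hbn : b < n / 2) (hka : k ≤ t + n - a) (hkb : k ≤ n - b) :
    ∃ C : ℝ≥0∞, C ≠ ⊤ ∧ ∃ N : ℕ, ∀ (φ u : 𝓢(E, ℂ)) (M : ℝ),
      (∀ m, k ≤ m → m ≤ N → ∫ x, ‖iteratedFDeriv ℝ m φ x‖ ≤ M) →
      hsobENorm t (fun x => φ x * u x) ≤
        C * ENNReal.ofReal M * (hsobENorm a u + hsobENorm (t + b) u) := by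
  obtain ⟨C, hC, h⟩ := exists_hsobENorm_mul_le (n := n) ht ha han hb hbn
  obtain ⟨C', hC', h'⟩ := exists_pow_mul_norm_fourierT_le (n := n)
  refine ⟨C * (2 * ENNReal.ofReal C'), ENNReal.mul_ne_top hC
    (ENNReal.mul_ne_top (by norm_num) ENNReal.ofReal_ne_top),
    max k (max ⌈t + n - a⌉₊ ⌈(n : ℝ) - b⌉₊), fun φ u M hM => ?_⟩
  set K := 2 * ENNReal.ofReal C' * ENNReal.ofReal M with hK
  have key : ∀ p : ℝ, k ≤ p → ⌈p⌉₊ ≤ max k (max ⌈t + n - a⌉₊ ⌈(n : ℝ) - b⌉₊) →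
      ∀ ζ : E, ‖ζ‖ₑ ^ p * ‖fourierT φ ζ‖ₑ ≤ K := by
    intro p hp hpN ζ
    have hm : ∀ m, k ≤ m → m ≤ max k (max ⌈t + n - a⌉₊ ⌈(n : ℝ) - b⌉₊) →
        ‖ζ‖ₑ ^ m * ‖fourierT φ ζ‖ₑ ≤ ENNReal.ofReal C' * ENNReal.ofReal M := by
      intro m hkm hmN
      rw [← ofReal_norm ζ, ← ofReal_norm (fourierT φ ζ), ← ENNReal.ofReal_pow (norm_nonneg _),
        ← ENNReal.ofReal_mul (by positivity), ← ENNReal.ofReal_mul hC']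
      refine ENNReal.ofReal_le_ofReal ((h' φ m ζ).trans ?_)
      gcongr
      exact hM m hkm hmN
    calc ‖ζ‖ₑ ^ p * ‖fourierT φ ζ‖ₑ ≤ (‖ζ‖ₑ ^ k + ‖ζ‖ₑ ^ ⌈p⌉₊) * ‖fourierT φ ζ‖ₑ := by
          gcongr
          exact ENNReal.rpow_le_pow_add_pow_ceil _ hp
      _ = ‖ζ‖ₑ ^ k * ‖fourierT φ ζ‖ₑ + ‖ζ‖ₑ ^ ⌈p⌉₊ * ‖fourierT φ ζ‖ₑ := add_mul _ _ _
      _ ≤ ENNReal.ofReal C' * ENNReal.ofReal M + ENNReal.ofReal C' * ENNReal.ofReal M :=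
          add_le_add (hm k le_rfl (le_max_left _ _))
            (hm _ (by exact_mod_cast hp.trans (Nat.le_ceil p)) hpN)
      _ = K := by rw [hK]; ring
  refine (h φ u K K (key _ hka (by simp)) (key _ hkb (by simp))).trans (le_of_eq ?_)
  rw [hK]
  ring

/-- Multiplication by a fixed Schwartz function between homogeneous Sobolev spaces. -/
lemma SchwartzMap.exists_hsobENorm_mul_le (φ : 𝓢(E, ℂ)) {t a b : ℝ} (ht : 0 ≤ t) (ha : 0 < a)
    (han : a < n / 2) (hb : 0 < b) (hbn : b < n / 2) :
    ∃ C : ℝ≥0∞, C ≠ ⊤ ∧ ∀ u : 𝓢(E, ℂ),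
      hsobENorm t (fun x => φ x * u x) ≤ C * (hsobENorm a u + hsobENorm (t + b) u) := by
  obtain ⟨C, hC, N, h⟩ := exists_hsobENorm_mul_le_of_integral (n := n) (k := 0) ht ha han hb hbn
    (by push_cast; linarith) (by push_cast; linarith)
  refine ⟨C * ENNReal.ofReal (∑ m ∈ Finset.range (N + 1), ∫ x, ‖iteratedFDeriv ℝ m φ x‖),
    ENNReal.mul_ne_top hC ENNReal.ofReal_ne_top, fun u => h φ u _ fun m _ hm => ?_⟩
  exact Finset.single_le_sum (f := fun m => ∫ x, ‖iteratedFDeriv ℝ m φ x‖)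
    (fun i _ => integral_nonneg fun _ => norm_nonneg _) (Finset.mem_range.2 (by omega))

/-- A smooth radial cutoff: equal to `1` on the unit ball and to `0` outside the ball of
radius `2`. -/
noncomputable def radialCutoff (x : E) : ℂ := (Real.smoothTransition (2 - ‖x‖ ^ 2) : ℝ)

lemma radialCutoff_eq_one {x : E} (hx : ‖x‖ ≤ 1) : radialCutoff x = 1 := by
  rw [radialCutoff, Real.smoothTransition.one_of_one_le, Complex.ofReal_one]
  nlinarith [norm_nonneg x]

lemma radialCutoff_eq_zero {x : E} (hx : 2 ≤ ‖x‖) : radialCutoff x = 0 := by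
  rw [radialCutoff, Real.smoothTransition.zero_of_nonpos, Complex.ofReal_zero]
  nlinarith

/-- The cutoff depends on |x|², not |x|, so there is no singularity at the origin. -/
lemma contDiff_radialCutoff : ContDiff ℝ ∞ (radialCutoff : E → ℂ) :=
  Complex.ofRealCLM.contDiff.comp
    (Real.smoothTransition.contDiff.comp (contDiff_const.sub (contDiff_norm_sq ℝ)))

/-- The radial cutoff at scale `R`, as a test function. -/
noncomputable def scaledCutoff (n : ℕ) (R : ℝ) (hR : 0 < R) : RadialTest n :=
  ⟨fun x => radialCutoff (R⁻¹ • x), contDiff_radialCutoff.comp (contDiff_const_smul _),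
    HasCompactSupport.intro (isCompact_closedBall 0 (2 * R)) fun x hx => by
      refine radialCutoff_eq_zero ?_
      rw [mem_closedBall_zero_iff, not_le] at hx
      rw [norm_smul, norm_inv, Real.norm_of_nonneg hR.le, inv_mul_eq_div, le_div_iff₀ hR]
      exact hx.le,
    fun x y h => by simp [radialCutoff, norm_smul, h]⟩

lemma scaledCutoff_eq_one {R : ℝ} (hR : 0 < R) {x : E} (hx : ‖x‖ ≤ R) :
    (scaledCutoff n R hR).1 x = 1 := by
  refine radialCutoff_eq_one ?_
  rw [norm_smul, norm_inv, Real.norm_of_nonneg hR.le, inv_mul_eq_div, div_le_one hR]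
  exact hx

lemma one_add_pow_le_two_pow_mul {x : ℝ} (hx : 0 ≤ x) (k : ℕ) :
    (1 + x) ^ k ≤ 2 ^ k * (1 + x ^ k) := by
  rcases le_total x 1 with h | h
  · calc (1 + x) ^ k ≤ 2 ^ k := by gcongr; linarith
      _ ≤ _ := le_mul_of_one_le_right (by positivity) (by have := pow_nonneg hx k; linarith)
  · calc (1 + x) ^ k ≤ (2 * x) ^ k := by gcongr; linarith
      _ = 2 ^ k * x ^ k := mul_pow _ _ _
      _ ≤ _ := by gcongr; linarith

/-- The cutoffs are symbols of order 0 uniformly in R ≥ 1: the chain rule gives a factor R^{-k},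
which turns |x|^k into |x/R|^k, absorbed by a Schwartz seminorm of the fixed cutoff. -/
lemma exists_iteratedFDeriv_scaledCutoff_le (k : ℕ) : ∃ C : ℝ, 0 ≤ C ∧ ∀ (R : ℝ) (hR : 1 ≤ R)
    (x : E), (1 + ‖x‖) ^ k *
      ‖iteratedFDeriv ℝ k (scaledCutoff n R (zero_lt_one.trans_le hR)).1 x‖ ≤ C := by
  set χ : 𝓢(E, ℂ) :=
    (scaledCutoff n 1 zero_lt_one).2.2.1.toSchwartzMap (scaledCutoff n 1 zero_lt_one).2.1
  have hχ : ∀ x : E, χ x = radialCutoff x := fun x => by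
    change radialCutoff ((1 : ℝ)⁻¹ • x) = _
    simp
  obtain ⟨C₁, hC₁, h₁⟩ := χ.decay 0 k
  obtain ⟨C₂, hC₂, h₂⟩ := χ.decay k k
  refine ⟨2 ^ k * (C₁ + C₂), by positivity, fun R hR x => ?_⟩
  have hR0 : 0 < R := zero_lt_one.trans_le hR
  have e : (scaledCutoff n R hR0).1 = fun x => χ (R⁻¹ • x) := by
    ext x
    rw [hχ]
    rfl
  have hd : ‖iteratedFDeriv ℝ k (scaledCutoff n R hR0).1 x‖ =
      (R⁻¹) ^ k * ‖iteratedFDeriv ℝ k χ (R⁻¹ • x)‖ := by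
    rw [e, iteratedFDeriv_comp_const_smul (R⁻¹) (χ.smooth k), norm_smul, norm_pow,
      Real.norm_of_nonneg (by positivity)]
  have hRk : (R⁻¹) ^ k ≤ 1 := pow_le_one₀ (by positivity) (inv_le_one_of_one_le₀ hR)
  have b₁ := h₁ (R⁻¹ • x)
  have b₂ := h₂ (R⁻¹ • x)
  rw [pow_zero, one_mul] at b₁
  rw [norm_smul, norm_inv, Real.norm_of_nonneg hR0.le, mul_pow] at b₂
  calc (1 + ‖x‖) ^ k * ‖iteratedFDeriv ℝ k (scaledCutoff n R hR0).1 x‖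
      ≤ 2 ^ k * (1 + ‖x‖ ^ k) * ((R⁻¹) ^ k * ‖iteratedFDeriv ℝ k χ (R⁻¹ • x)‖) := by
        rw [hd]
        gcongr
        exact one_add_pow_le_two_pow_mul (norm_nonneg x) k
    _ = 2 ^ k * ((R⁻¹) ^ k * ‖iteratedFDeriv ℝ k χ (R⁻¹ • x)‖ +
          (R⁻¹) ^ k * ‖x‖ ^ k * ‖iteratedFDeriv ℝ k χ (R⁻¹ • x)‖) := by ring
    _ ≤ 2 ^ k * (1 * C₁ + C₂) := by gcongr
    _ = _ := by ring

/-- `V` is a symbol of order `-2`. -/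
def IsSymbolNegTwo (V : E → ℂ) : Prop :=
  ∀ k : ℕ, ∃ C : ℝ, 0 ≤ C ∧ ∀ x : E, (1 + ‖x‖) ^ (k + 2) * ‖iteratedFDeriv ℝ k V x‖ ≤ C

lemma isSymbolNegTwo_of_decay {V : E → ℂ} (hdecay : ∀ k : ℕ, ∃ C : ℝ, ∀ x : E,
    ‖iteratedFDeriv ℝ k V x‖ ≤ C * Real.sqrt (1 + ‖x‖ ^ 2) ^ (-2 - (k : ℝ))) :
    IsSymbolNegTwo V := by
  intro k
  obtain ⟨C, hC⟩ := hdecay k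
  refine ⟨2 ^ (k + 2) * |C|, by positivity, fun x => ?_⟩
  set J := Real.sqrt (1 + ‖x‖ ^ 2) with hJ
  have hJ0 : 0 < J := Real.sqrt_pos.2 (by positivity)
  have hJ1 : 1 + ‖x‖ ≤ 2 * J := by
    have h1 : 1 ≤ J := Real.one_le_sqrt.2 (by nlinarith [norm_nonneg x])
    have h2 : ‖x‖ ≤ J := Real.le_sqrt_of_sq_le (by linarith)
    linarith
  have e : J ^ (-2 - (k : ℝ)) = (J ^ (k + 2))⁻¹ := by
    rw [← Real.rpow_natCast, ← Real.rpow_neg hJ0.le]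
    congr 1
    push_cast
    ring
  calc (1 + ‖x‖) ^ (k + 2) * ‖iteratedFDeriv ℝ k V x‖
      ≤ (2 * J) ^ (k + 2) * (|C| * (J ^ (k + 2))⁻¹) := by
        gcongr
        rw [← e]
        refine (hC x).trans ?_
        gcongr
        exact le_abs_self C
    _ = 2 ^ (k + 2) * |C| * (J ^ (k + 2) * (J ^ (k + 2))⁻¹) := by ring
    _ = _ := by rw [mul_inv_cancel₀ (by positivity), mul_one]

/-- By the Leibniz rule, order -2 times order 0 is again of order -2, with constants independent of
R. -/
lemma IsSymbolNegTwo.exists_mul_scaledCutoff_le {V : E → ℂ} (hV : ContDiff ℝ ∞ V)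
    (hs : IsSymbolNegTwo V) (k : ℕ) : ∃ C : ℝ, 0 ≤ C ∧ ∀ (R : ℝ) (hR : 1 ≤ R) (x : E),
      (1 + ‖x‖) ^ (k + 2) * ‖iteratedFDeriv ℝ k
        (fun y => V y * (scaledCutoff n R (zero_lt_one.trans_le hR)).1 y) x‖ ≤ C := by
  choose A hA0 hA using hs
  choose B hB0 hB using exists_iteratedFDeriv_scaledCutoff_le (n := n)
  refine ⟨∑ i ∈ Finset.range (k + 1), (k.choose i : ℝ) * (A i * B (k - i)),
    Finset.sum_nonneg fun i _ => by have := hA0 i; have := hB0 (k - i); positivity,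
    fun R hR x => ?_⟩
  refine (mul_le_mul_of_nonneg_left (norm_iteratedFDeriv_mul_le (N := ∞) hV
    (scaledCutoff n R (zero_lt_one.trans_le hR)).2.1 x (by exact_mod_cast le_top))
    (by positivity)).trans ?_
  rw [Finset.mul_sum]
  refine Finset.sum_le_sum fun i hi => ?_
  have hik : k + 2 = (i + 2) + (k - i) := by have := Finset.mem_range.1 hi; omega
  calc _ = (k.choose i : ℝ) * (((1 + ‖x‖) ^ (i + 2) * ‖iteratedFDeriv ℝ i V x‖) *
        ((1 + ‖x‖) ^ (k - i) * ‖iteratedFDeriv ℝ (k - i)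
          (scaledCutoff n R (zero_lt_one.trans_le hR)).1 x‖)) := by
        rw [hik, pow_add]
        ring
    _ ≤ _ := by
        have := hA0 i
        gcongr
        · exact hA i x
        · exact hB (k - i) R hR x

end SymbolDecay

/-! ### Smallness of the potential near spatial infinity. -/

section Tail

variable {n : ℕ}

local notation "E" => EuclideanSpace ℝ (Fin n)

/-- A radial test function as a Schwartz function. -/
noncomputable def RadialTest.toSchwartz (u : RadialTest n) : 𝓢(E, ℂ) :=
  u.2.2.1.toSchwartzMap u.2.1

@[simp]
lemma RadialTest.coe_toSchwartz (u : RadialTest n) : ((RadialTest.toSchwartz u) : E → ℂ) = u.1 := rfl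

/-- The derivative vanishes for |x| < R and is O((1 + |x|)^{-m-2}) uniformly in both radii. Since m
+ 2 ≥ n + 1, half a power can be traded for R^{-1/2} while (1 + |x|)^{-n-1/2} remains integrable.
Independence of R' is essential for the tail estimate. -/
lemma IsSymbolNegTwo.exists_integral_iteratedFDeriv_le {V : E → ℂ} (hV : ContDiff ℝ ∞ V)
    (hs : IsSymbolNegTwo V) {m : ℕ} (hm : n ≤ m + 1) :
    ∃ C : ℝ, 0 ≤ C ∧ ∀ (R R' : ℝ) (hR : 1 ≤ R) (hR' : R ≤ R'),
      ∫ x, ‖iteratedFDeriv ℝ m (fun y => V y *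
        ((scaledCutoff n R' (zero_lt_one.trans_le (hR.trans hR'))).1 y -
          (scaledCutoff n R (zero_lt_one.trans_le hR)).1 y)) x‖ ≤ C * R ^ (-(1 / 2) : ℝ) := by
  obtain ⟨C, hC, h⟩ := hs.exists_mul_scaledCutoff_le hV m
  have hint : Integrable fun x : E => (1 + ‖x‖) ^ (-((n : ℝ) + 1 / 2)) :=
    integrable_one_add_norm (by simp)
  refine ⟨2 * C * ∫ x : E, (1 + ‖x‖) ^ (-((n : ℝ) + 1 / 2)),
    mul_nonneg (by positivity) (integral_nonneg fun x => by positivity), fun R R' hR hR' => ?_⟩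
  set χ := scaledCutoff n R (zero_lt_one.trans_le hR) with hχ
  set χ' := scaledCutoff n R' (zero_lt_one.trans_le (hR.trans hR')) with hχ'
  have hR0 : 0 < R := zero_lt_one.trans_le hR
  have hpt : ∀ x : E, ‖iteratedFDeriv ℝ m (fun y => V y * (χ'.1 y - χ.1 y)) x‖ ≤
      2 * C * R ^ (-(1 / 2) : ℝ) * (1 + ‖x‖) ^ (-((n : ℝ) + 1 / 2)) := by
    intro x
    rcases lt_or_ge ‖x‖ R with hx | hx
    · have hev : (fun y => V y * (χ'.1 y - χ.1 y)) =ᶠ[nhds x] fun _ => 0 := by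
        filter_upwards [(isOpen_lt continuous_norm continuous_const).mem_nhds hx] with y hy
        have hy' : ‖y‖ < R := hy
        rw [hχ, hχ', scaledCutoff_eq_one _ hy'.le, scaledCutoff_eq_one _ (hy'.le.trans hR'),
          sub_self, mul_zero]
      rw [(hev.iteratedFDeriv ℝ m).eq_of_nhds, iteratedFDeriv_fun_zero]
      simp only [Pi.zero_apply, norm_zero]
      positivity
    · have e : (fun y => V y * (χ'.1 y - χ.1 y)) =
          (fun y => V y * χ'.1 y) - fun y => V y * χ.1 y := by
        ext y
        simp [mul_sub]
      have c1 : ContDiffAt ℝ m (fun y => V y * χ'.1 y) x :=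
        ((hV.mul χ'.2.1).of_le (by exact_mod_cast le_top)).contDiffAt
      have c2 : ContDiffAt ℝ m (fun y => V y * χ.1 y) x :=
        ((hV.mul χ.2.1).of_le (by exact_mod_cast le_top)).contDiffAt
      have hw : 0 < 1 + ‖x‖ := by positivity
      have hsum : (1 + ‖x‖) ^ (m + 2) *
          ‖iteratedFDeriv ℝ m (fun y => V y * (χ'.1 y - χ.1 y)) x‖ ≤ 2 * C := by
        rw [e, iteratedFDeriv_sub_apply c1 c2]
        calc _ ≤ (1 + ‖x‖) ^ (m + 2) * (‖iteratedFDeriv ℝ m (fun y => V y * χ'.1 y) x‖ +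
              ‖iteratedFDeriv ℝ m (fun y => V y * χ.1 y) x‖) := by
              gcongr
              exact norm_sub_le _ _
          _ ≤ C + C := by
              rw [mul_add]
              exact add_le_add (h R' (hR.trans hR') x) (h R hR x)
          _ = 2 * C := by ring
      have hpow : (1 + ‖x‖) ^ (n + 1) ≤ (1 + ‖x‖) ^ (m + 2) :=
        pow_le_pow_right₀ (by linarith [norm_nonneg x]) (by omega)
      have hnp : (1 + ‖x‖) ^ (-((n : ℝ) + 1 / 2)) =
          ((1 + ‖x‖) ^ (n + 1))⁻¹ * (1 + ‖x‖) ^ (1 / 2 : ℝ) := by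
        rw [← Real.rpow_natCast, ← Real.rpow_neg hw.le, ← Real.rpow_add hw]
        congr 1
        push_cast
        ring
      have hR2 : 1 ≤ R ^ (-(1 / 2) : ℝ) * (1 + ‖x‖) ^ (1 / 2 : ℝ) := by
        rw [Real.rpow_neg hR0.le, inv_mul_eq_div, one_le_div (by positivity)]
        exact Real.rpow_le_rpow hR0.le (by linarith) (by norm_num)
      calc ‖iteratedFDeriv ℝ m (fun y => V y * (χ'.1 y - χ.1 y)) x‖
          ≤ 2 * C * ((1 + ‖x‖) ^ (n + 1))⁻¹ := by
            rw [← div_eq_mul_inv, le_div_iff₀ (by positivity), mul_comm]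
            refine le_trans ?_ hsum
            gcongr
        _ ≤ 2 * C * ((1 + ‖x‖) ^ (n + 1))⁻¹ *
              (R ^ (-(1 / 2) : ℝ) * (1 + ‖x‖) ^ (1 / 2 : ℝ)) :=
            le_mul_of_one_le_right (by positivity) hR2
        _ = _ := by rw [hnp]; ring
  calc _ ≤ ∫ x : E, 2 * C * R ^ (-(1 / 2) : ℝ) * (1 + ‖x‖) ^ (-((n : ℝ) + 1 / 2)) :=
        integral_mono_of_nonneg (Filter.Eventually.of_forall fun x => norm_nonneg _)
          (hint.const_mul _) (Filter.Eventually.of_forall hpt)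
    _ = _ := by rw [integral_const_mul]; ring

/-- Multiplication by the part of `V` at spatial infinity is small. -/
lemma IsSymbolNegTwo.exists_hsobENorm_tail_le {V : E → ℂ} (hV : ContDiff ℝ ∞ V)
    (hVr : IsRadial V) (hs : IsSymbolNegTwo V) {t a b : ℝ} (ht : 0 ≤ t) (ha : 0 < a)
    (han : a < n / 2) (hb : 0 < b) (hb1 : b ≤ 1) (hbn : b < n / 2) (hat : a ≤ t + 1) :
    ∃ C : ℝ≥0∞, C ≠ ⊤ ∧ ∀ (R : ℝ) (hR : 1 ≤ R) (u : RadialTest n),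
      hsobENorm t (fun x => V x * u.1 x -
        V x * (scaledCutoff n R (zero_lt_one.trans_le hR)).1 x * u.1 x) ≤
        C * ENNReal.ofReal (R ^ (-(1 / 2) : ℝ)) * (hsobENorm a u.1 + hsobENorm (t + b) u.1) := by
  have hn' : (0 : ℝ) < n := by linarith
  have hn : 1 ≤ n := by exact_mod_cast hn'
  -- Order n - 1 is where the derivatives of a symbol of order -2 are guaranteed to be integrable;
  -- the two side conditions become a ≤ t + 1 and b ≤ 1.
  obtain ⟨C, hC, N, h⟩ := exists_hsobENorm_mul_le_of_integral (n := n) (k := n - 1) ht ha han hb hbn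
    (by push_cast [Nat.cast_sub hn]; linarith) (by push_cast [Nat.cast_sub hn]; linarith)
  have hD : ∀ m : ℕ, ∃ D : ℝ, 0 ≤ D ∧ (n ≤ m + 1 → ∀ (R R' : ℝ) (hR : 1 ≤ R) (hR' : R ≤ R'),
      ∫ x, ‖iteratedFDeriv ℝ m (fun y => V y *
        ((scaledCutoff n R' (zero_lt_one.trans_le (hR.trans hR'))).1 y -
          (scaledCutoff n R (zero_lt_one.trans_le hR)).1 y)) x‖ ≤ D * R ^ (-(1 / 2) : ℝ)) := by
    intro m
    by_cases hm : n ≤ m + 1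
    · obtain ⟨D, hD, h⟩ := hs.exists_integral_iteratedFDeriv_le hV hm
      exact ⟨D, hD, fun _ => h⟩
    · exact ⟨0, le_rfl, fun h => absurd h hm⟩
  choose D hD0 hD using hD
  refine ⟨C * ENNReal.ofReal (∑ m ∈ Finset.range (N + 1), D m),
    ENNReal.mul_ne_top hC ENNReal.ofReal_ne_top, fun R hR u => ?_⟩
  have hR0 : 0 < R := zero_lt_one.trans_le hR
  obtain ⟨ρ, hρ⟩ := u.2.2.1.isCompact.isBounded.subset_closedBall 0
  -- The outer cutoff equals 1 on the support of u, so 1 - χ may be replaced by the compactly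
  -- supported χ' - χ. Its radius depends on u, but the bounds do not see it.
  set R' := max R ρ
  have hR' : R ≤ R' := le_max_left _ _
  set χ := scaledCutoff n R hR0 with hχ
  set χ' := scaledCutoff n R' (hR0.trans_le hR') with hχ'
  set φ : RadialTest n := RadialTest.mulLeft V hV hVr (χ' - χ) with hφ
  have e : (fun x => V x * u.1 x - V x * χ.1 x * u.1 x) =
      fun x => (RadialTest.toSchwartz φ) x * (RadialTest.toSchwartz u) x := by
    ext x
    change V x * u.1 x - V x * χ.1 x * u.1 x = V x * (χ'.1 x - χ.1 x) * u.1 x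
    by_cases hx : u.1 x = 0
    · simp [hx]
    · have hxρ : ‖x‖ ≤ R' := by
        have := hρ (subset_tsupport _ hx)
        rw [mem_closedBall_zero_iff] at this
        exact this.trans (le_max_right _ _)
      rw [hχ', scaledCutoff_eq_one _ hxρ]
      ring
  rw [e]
  refine (h (RadialTest.toSchwartz φ) (RadialTest.toSchwartz u)
    ((∑ m ∈ Finset.range (N + 1), D m) * R ^ (-(1 / 2) : ℝ)) fun m hm hmN => ?_).trans
    (le_of_eq ?_)
  · refine (hD m (by omega) R R' hR hR').trans ?_
    gcongr
    exact Finset.single_le_sum (f := D) (fun i _ => hD0 i) (Finset.mem_range.2 (by omega))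
  · rw [ENNReal.ofReal_mul (Finset.sum_nonneg fun i _ => hD0 i)]
    simp only [RadialTest.coe_toSchwartz, mul_assoc]

end Tail

/-! ### Local L¹ control and regularity of the Fourier transform. -/

section LocalEstimates

variable {n : ℕ}

local notation "E" => EuclideanSpace ℝ (Fin n)

/-- This is Plancherel; the constant only accounts for the change of normalization and the rescaling
by 2π. -/
lemma exists_eLpNorm_two_le_hsobENorm_zero :
    ∃ C : ℝ≥0∞, C ≠ ⊤ ∧ ∀ f : 𝓢(E, ℂ), eLpNorm f 2 volume ≤ C * hsobENorm 0 f := by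
  set c : ℂ := (((2 * Real.pi) ^ (-(n : ℝ) / 2) : ℝ) : ℂ) with hc
  have hc0 : c ≠ 0 := by
    rw [hc, Ne, Complex.ofReal_eq_zero]
    positivity
  set r : ℝ := (2 * Real.pi)⁻¹ with hr
  have hr0 : 0 < r := by positivity
  have hrn : ENNReal.ofReal r ^ (n : ℝ) ≠ ⊤ :=
    ENNReal.rpow_ne_top_of_nonneg (Nat.cast_nonneg n) ENNReal.ofReal_ne_top
  refine ⟨(ENNReal.ofReal r ^ (n : ℝ) * ‖c⁻¹‖ₑ ^ (2 : ℝ)) ^ (1 / 2 : ℝ),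
    ENNReal.rpow_ne_top_of_nonneg (by norm_num) (ENNReal.mul_ne_top hrn
      (ENNReal.rpow_ne_top_of_nonneg (by norm_num) enorm_ne_top)), fun f => ?_⟩
  have hpl : eLpNorm f 2 volume = eLpNorm (𝓕 f : 𝓢(E, ℂ)) 2 volume := by
    have h := SchwartzMap.norm_fourier_toL2_eq f
    rw [SchwartzMap.norm_toLp, SchwartzMap.norm_toLp] at h
    have h1 : eLpNorm f 2 volume ≠ ⊤ := (f.memLp 2 volume).eLpNorm_ne_top
    have h2 : eLpNorm (𝓕 f : 𝓢(E, ℂ)) 2 volume ≠ ⊤ :=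
      SchwartzMap.memLp (𝓕 f : 𝓢(E, ℂ)) 2 volume |>.eLpNorm_ne_top
    rw [← ENNReal.ofReal_toReal h1, ← ENNReal.ofReal_toReal h2, h]
  have hF : ∀ η : E, 𝓕 f (r • η) = c⁻¹ * fourierT f η := by
    intro η
    rw [fourierT_eq, ← hc, ← hr, inv_mul_cancel_left₀ hc0]
  rw [hpl, hsobENorm_eq le_rfl, eLpNorm_eq_lintegral_rpow_enorm_toReal (by norm_num) (by norm_num),
    eLpNorm_eq_lintegral_rpow_enorm_toReal (by norm_num) (by norm_num),
    ENNReal.toReal_ofNat, ← ENNReal.mul_rpow_of_nonneg _ _ (by norm_num)]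
  refine ENNReal.rpow_le_rpow ?_ (by norm_num)
  have m1 := (𝓕 f).continuous.measurable
  rw [lintegral_comp_smul_euclidean (by fun_prop) hr0, mul_assoc]
  gcongr ENNReal.ofReal r ^ (n : ℝ) * ?_
  rw [← lintegral_const_mul' _ _ (ENNReal.rpow_ne_top_of_nonneg (by norm_num) enorm_ne_top)]
  refine lintegral_mono fun η => ?_
  simp only [ENNReal.rpow_zero, one_mul, enorm_eq_self]
  rw [hF, enorm_mul, ENNReal.mul_rpow_of_nonneg _ _ (by norm_num)]

/-- Local `L¹` bound by a homogeneous Sobolev norm. -/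
lemma RadialTest.exists_eLpNorm_one_mul_le (φ : RadialTest n) {a : ℝ} (ha : 0 < a)
    (han : a < n / 2) : ∃ C : ℝ≥0∞, C ≠ ⊤ ∧ ∀ u : RadialTest n,
      eLpNorm (fun x => φ.1 x * u.1 x) 1 volume ≤ C * hsobENorm a u.1 := by
  -- With t = 0 and b = a the product estimate bounds φu in L² by the single norm of order a; Hölder
  -- on the support of φ then passes to L¹.
  obtain ⟨C, hC, h⟩ := (RadialTest.toSchwartz φ).exists_hsobENorm_mul_le le_rfl ha han ha han
  obtain ⟨C', hC', h'⟩ := exists_eLpNorm_two_le_hsobENorm_zero (n := n)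
  set K := tsupport φ.1 with hK
  have hKm : volume K ≠ ⊤ := φ.2.2.1.isCompact.measure_lt_top.ne
  refine ⟨C' * (C * 2) * volume K ^ (1 / 2 : ℝ), ENNReal.mul_ne_top (ENNReal.mul_ne_top hC'
    (ENNReal.mul_ne_top hC (by norm_num))) (ENNReal.rpow_ne_top_of_nonneg (by norm_num) hKm),
    fun u => ?_⟩
  have hsupp : Function.support (fun x => φ.1 x * u.1 x) ⊆ K := fun x hx =>
    subset_tsupport _ (left_ne_zero_of_mul hx)
  have hcont : Continuous fun x => φ.1 x * u.1 x := φ.2.1.continuous.mul u.2.1.continuous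
  calc eLpNorm (fun x => φ.1 x * u.1 x) 1 volume
      = eLpNorm (fun x => φ.1 x * u.1 x) 1 (volume.restrict K) :=
        (eLpNorm_restrict_eq_of_support_subset hsupp).symm
    _ ≤ eLpNorm (fun x => φ.1 x * u.1 x) 2 (volume.restrict K) *
          (volume.restrict K) Set.univ ^ (1 / (1 : ℝ≥0∞).toReal - 1 / (2 : ℝ≥0∞).toReal) :=
        eLpNorm_le_eLpNorm_mul_rpow_measure_univ (by norm_num) hcont.aestronglyMeasurable
    _ = eLpNorm (fun x => φ.1 x * u.1 x) 2 volume * volume K ^ (1 / 2 : ℝ) := by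
        rw [eLpNorm_restrict_eq_of_support_subset hsupp, Measure.restrict_apply_univ]
        norm_num
    _ ≤ C' * (C * (hsobENorm a u.1 + hsobENorm a u.1)) * volume K ^ (1 / 2 : ℝ) := by
        gcongr
        refine (h' (RadialTest.toSchwartz (RadialTest.mulLeft φ.1 φ.2.1 φ.2.2.2 u))).trans ?_
        gcongr
        have := h (RadialTest.toSchwartz u)
        rw [zero_add] at this
        exact this
    _ = _ := by ring

lemma norm_fourierT_le (w : E → ℂ) (ξ : E) :
    ‖fourierT w ξ‖ ≤ (2 * Real.pi) ^ (-(n : ℝ) / 2) * ∫ x, ‖w x‖ := by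
  rw [fourierT, norm_mul, Complex.norm_real, Real.norm_of_nonneg (by positivity)]
  gcongr
  refine (norm_integral_le_integral_norm _).trans (le_of_eq (integral_congr_ae ?_))
  filter_upwards with x
  rw [norm_mul, Complex.norm_exp]
  simp

/-- The phase difference is at most |ξ - ξ'||x| ≤ ρ|ξ - ξ'| on the support, by |e^{iθ} - 1| ≤ |θ|.
-/
lemma norm_fourierT_sub_le {w : E → ℂ} (hw : Integrable w) {ρ : ℝ}
    (hρ : ∀ x, w x ≠ 0 → ‖x‖ ≤ ρ) (ξ ξ' : E) :
    ‖fourierT w ξ - fourierT w ξ'‖ ≤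
      (2 * Real.pi) ^ (-(n : ℝ) / 2) * ((ρ * ‖ξ - ξ'‖) * ∫ x, ‖w x‖) := by
  have hint : ∀ ξ : E, Integrable fun x =>
      w x * Complex.exp (-Complex.I * ((inner ℝ ξ x : ℝ) : ℂ)) := by
    intro ξ
    refine hw.mul_bdd (c := 1) (by fun_prop) (Filter.Eventually.of_forall fun x => ?_)
    rw [Complex.norm_exp]
    simp
  rw [fourierT, fourierT, ← mul_sub, norm_mul, Complex.norm_real,
    Real.norm_of_nonneg (by positivity), ← integral_sub (hint ξ) (hint ξ')]
  gcongr
  rw [← integral_const_mul]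
  refine norm_integral_le_of_norm_le (hw.norm.const_mul _) (Filter.Eventually.of_forall fun x => ?_)
  by_cases hx : w x = 0
  · simp [hx]
  have hexp : Complex.exp (-Complex.I * ((inner ℝ ξ x : ℝ) : ℂ)) -
      Complex.exp (-Complex.I * ((inner ℝ ξ' x : ℝ) : ℂ)) =
      Complex.exp (-Complex.I * ((inner ℝ ξ' x : ℝ) : ℂ)) *
        (Complex.exp (Complex.I * ((inner ℝ (ξ' - ξ) x : ℝ) : ℂ)) - 1) := by
    rw [mul_sub, ← Complex.exp_add, mul_one, inner_sub_left]
    congr 2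
    push_cast
    ring
  rw [← mul_sub, hexp, norm_mul, norm_mul, mul_comm]
  refine mul_le_mul_of_nonneg_right ?_ (norm_nonneg _)
  have h1 : ‖Complex.exp (-Complex.I * ((inner ℝ ξ' x : ℝ) : ℂ))‖ = 1 := by
    rw [Complex.norm_exp]
    simp
  rw [h1, one_mul]
  refine (Real.norm_exp_I_mul_ofReal_sub_one_le).trans ?_
  calc ‖inner ℝ (ξ' - ξ) x‖ ≤ ‖ξ' - ξ‖ * ‖x‖ := norm_inner_le_norm _ _
    _ ≤ ρ * ‖ξ - ξ'‖ := by
      rw [norm_sub_rev, mul_comm]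
      gcongr
      exact hρ x hx

end LocalEstimates

/-! ### Compact operators from square integrable dual-valued kernels. -/

section KernelOperators

variable {X : Type*} [SeminormedAddCommGroup X] [NormedSpace ℂ X]

/-- The dual of a seminormed space is a normed group. -/
noncomputable instance instNormedAddCommGroupDualOfSeminormed :
    NormedAddCommGroup (X →L[ℂ] ℂ) :=
  NormedAddCommGroup.ofSeparation fun f hf => by
    ext x
    have h := f.le_opNorm x
    rw [hf, zero_mul] at h
    simpa using h

variable {α : Type*} [MeasurableSpace α] {μ : Measure α}

/-- The operator `x ↦ (ξ ↦ k ξ x)` attached to a square integrable function `k` with values in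
the dual. -/
noncomputable def kernelOperator : Lp (X →L[ℂ] ℂ) 2 μ →L[ℂ] X →L[ℂ] Lp ℂ 2 μ :=
  (LinearMap.mkContinuous₂ (LinearMap.mk₂ ℂ
    (fun (x : X) (k : Lp (X →L[ℂ] ℂ) 2 μ) =>
      (ContinuousLinearMap.apply ℂ ℂ x : (X →L[ℂ] ℂ) →L[ℂ] ℂ).compLpL 2 μ k)
    (fun x y k => by rw [map_add, ContinuousLinearMap.add_compLpL, add_apply])
    (fun c x k => by rw [map_smul, ContinuousLinearMap.smul_compLpL, smul_apply])
    (fun x k l => map_add _ k l)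
    (fun c x k => map_smul _ c k)) 1 (fun x k => by
      rw [one_mul]
      refine (ContinuousLinearMap.norm_compLp_le _ k).trans ?_
      gcongr
      refine ContinuousLinearMap.opNorm_le_bound _ (norm_nonneg x) fun f => ?_
      rw [mul_comm]
      exact f.le_opNorm x)).flip

lemma coeFn_kernelOperator (k : Lp (X →L[ℂ] ℂ) 2 μ) (x : X) :
    kernelOperator k x =ᵐ[μ] fun ξ => k ξ x :=
  (ContinuousLinearMap.apply ℂ ℂ x : (X →L[ℂ] ℂ) →L[ℂ] ℂ).coeFn_compLp' k

/-- Simple kernels give finite-rank operators and are dense in L². The operator depends continuously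
on its kernel, and compact operators form a closed set. -/
lemma isCompactOperator_kernelOperator (k : Lp (X →L[ℂ] ℂ) 2 μ) :
    IsCompactOperator (kernelOperator k) := by
  induction k using Lp.induction (by norm_num : (2 : ℝ≥0∞) ≠ ⊤) with
  | indicatorConst c hs hμs =>
    rename_i s
    set v : Lp ℂ 2 μ := indicatorConstLp 2 hs hμs.ne 1 with hv
    -- A constant functional c on a set s gives the rank-one operator x ↦ c(x) 1_s.
    have e : kernelOperator (Lp.simpleFunc.indicatorConst 2 hs hμs.ne c : Lp (X →L[ℂ] ℂ) 2 μ) =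
        (ContinuousLinearMap.toSpanSingleton ℂ v).comp c := by
      ext x
      refine (coeFn_kernelOperator _ x).trans ?_
      rw [Lp.simpleFunc.coe_indicatorConst]
      simp only [ContinuousLinearMap.comp_apply, ContinuousLinearMap.toSpanSingleton_apply]
      filter_upwards [Lp.coeFn_smul (c x) v,
        indicatorConstLp_coeFn (p := 2) (hs := hs) (hμs := hμs.ne) (c := c),
        indicatorConstLp_coeFn (p := 2) (hs := hs) (hμs := hμs.ne) (c := (1 : ℂ))] with ξ h1 h2 h3
      rw [h1, h2, Pi.smul_apply, hv, h3]
      by_cases hξ : ξ ∈ s <;> simp [hξ]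
    rw [e]
    have hc : IsCompactOperator c :=
      isCompactOperator_of_locallyCompactSpace_dom c
    exact (hc.clm_comp (ContinuousLinearMap.toSpanSingleton ℂ v) :)
  | add hf hg _ ihf ihg =>
    rw [map_add]
    exact ihf.add ihg
  | isClosed =>
    exact isClosed_setOfPred_isCompactOperator.preimage
      (kernelOperator (X := X) (μ := μ)).continuous

lemma isCompactOperator_of_forall_exists_norm_sub_le {Y : Type*} [NormedAddCommGroup Y]
    [NormedSpace ℂ Y] [CompleteSpace Y] {T : X →L[ℂ] Y}
    (h : ∀ ε > 0, ∃ S : X →L[ℂ] Y, IsCompactOperator S ∧ ∀ x, ‖T x - S x‖ ≤ ε * ‖x‖) :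
    IsCompactOperator T := by
  refine isClosed_setOfPred_isCompactOperator.closure_subset
    (SeminormedAddCommGroup.mem_closure_iff.2 fun ε hε => ?_)
  obtain ⟨S, hS, hTS⟩ := h (ε / 2) (by positivity)
  refine ⟨S, hS, lt_of_le_of_lt ?_ (half_lt_self hε)⟩
  exact ContinuousLinearMap.opNorm_le_bound _ (by positivity) hTS

end KernelOperators

/-! ### Homogeneous Sobolev norms as L² norms of weighted Fourier transforms. -/

section WeightedFourier

variable {n : ℕ}

local notation "E" => EuclideanSpace ℝ (Fin n)

lemma RadialTest.memLp_rpow_mul_fourierT {t : ℝ} (ht : 0 ≤ t) (u : RadialTest n) :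
    MemLp (fun ξ : E => ((‖ξ‖ ^ t : ℝ) : ℂ) * fourierT u.1 ξ) 2 volume := by
  have hc : Continuous fun ξ : E => ((‖ξ‖ ^ t : ℝ) : ℂ) * fourierT u.1 ξ :=
    (Complex.continuous_ofReal.comp (continuous_norm.rpow_const fun _ => Or.inr ht)).mul
      (RadialTest.toSchwartz u).continuous_fourierT
  refine (memLp_two_iff_integrable_sq_norm hc.aestronglyMeasurable).2 ?_
  have h := (integrable_hsobInner ht u u).norm
  refine h.congr (Filter.Eventually.of_forall fun ξ => ?_)
  simp only [inner_self_eq_norm_sq_to_K]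
  simp

/-- The map `u ↦ |·|ᵗ 𝓕u` from test functions to `L²`. -/
noncomputable def weightedFourier (n : ℕ) (t : ℝ) (ht : 0 ≤ t) :
    RadialTest n →ₗ[ℂ] Lp ℂ 2 (volume : Measure (EuclideanSpace ℝ (Fin n))) where
  toFun u := (RadialTest.memLp_rpow_mul_fourierT ht u).toLp _
  map_add' u v := by
    rw [← MemLp.toLp_add]
    refine MemLp.toLp_congr _ _ (Filter.Eventually.of_forall fun ξ => ?_)
    simp only [Pi.add_apply, ← mul_add]
    rw [← fourierT_add]
    rfl
  map_smul' c u := by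
    rw [RingHom.id_apply, ← MemLp.toLp_const_smul]
    refine MemLp.toLp_congr _ _ (Filter.Eventually.of_forall fun ξ => ?_)
    simp only [Pi.smul_apply, smul_eq_mul]
    exact (congrArg (((‖ξ‖ ^ t : ℝ) : ℂ) * ·) (fourierT_smul c u.1 ξ)).trans
      (mul_left_comm _ _ _)

lemma coeFn_weightedFourier {t : ℝ} (ht : 0 ≤ t) (u : RadialTest n) :
    weightedFourier n t ht u =ᵐ[volume] fun ξ => ((‖ξ‖ ^ t : ℝ) : ℂ) * fourierT u.1 ξ :=
  MemLp.coeFn_toLp (RadialTest.memLp_rpow_mul_fourierT ht u)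

lemma enorm_weightedFourier {t : ℝ} (ht : 0 ≤ t) (u : RadialTest n) :
    ‖weightedFourier n t ht u‖ₑ = hsobENorm t u.1 :=
  Lp.enorm_toLp (RadialTest.memLp_rpow_mul_fourierT ht u)

lemma re_hsobInner_self {t : ℝ} (ht : 0 ≤ t) (u : RadialTest n) :
    RCLike.re (hsobInner t u.1 u.1) = ‖weightedFourier n t ht u‖ ^ 2 := by
  rw [← inner_self_eq_norm_sq (𝕜 := ℂ), L2.inner_def, hsobInner]
  congr 1
  refine integral_congr_ae ?_
  filter_upwards [coeFn_weightedFourier ht u] with ξ hξ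
  rw [hξ]

/-- Multiplication by a smooth radial function, as a linear map on test functions. -/
def RadialTest.mulLeftLinear (V : E → ℂ) (hV : ContDiff ℝ ∞ V) (hVr : IsRadial V) :
    RadialTest n →ₗ[ℂ] RadialTest n where
  toFun := RadialTest.mulLeft V hV hVr
  map_add' u v := by
    ext x
    exact mul_add (V x) (u.1 x) (v.1 x)
  map_smul' c u := by
    ext x
    exact mul_left_comm (V x) c (u.1 x)

/-- Multiplication by a test function. -/
def RadialTest.mulTest (φ : RadialTest n) : RadialTest n →ₗ[ℂ] RadialTest n :=
  RadialTest.mulLeftLinear φ.1 φ.2.1 φ.2.2.2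

lemma norm_le_of_enorm_le {F G H : Type*} [SeminormedAddGroup F] [SeminormedAddGroup G]
    [SeminormedAddGroup H] {x : F} {y : G} {z : H} {C : ℝ≥0∞} (hC : C ≠ ⊤)
    (h : ‖x‖ₑ ≤ C * (‖y‖ₑ + ‖z‖ₑ)) : ‖x‖ ≤ C.toReal * (‖y‖ + ‖z‖) := by
  have h' := ENNReal.toReal_mono (ENNReal.mul_ne_top hC
    (ENNReal.add_ne_top.2 ⟨enorm_ne_top, enorm_ne_top⟩)) h
  rwa [ENNReal.toReal_mul, ENNReal.toReal_add enorm_ne_top enorm_ne_top, toReal_enorm,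
    toReal_enorm, toReal_enorm] at h'

lemma RadialTest.exists_norm_weightedFourier_mulTest_le (φ : RadialTest n) {t a b : ℝ}
    (ht : 0 ≤ t) (ha : 0 < a) (han : a < n / 2) (hb : 0 < b) (hbn : b < n / 2) :
    ∃ C : ℝ, 0 ≤ C ∧ ∀ u : RadialTest n, ‖weightedFourier n t ht (RadialTest.mulTest φ u)‖ ≤
      C * (‖weightedFourier n a ha.le u‖ + ‖weightedFourier n (t + b) (by positivity) u‖) := by
  obtain ⟨C, hC, h⟩ := (RadialTest.toSchwartz φ).exists_hsobENorm_mul_le ht ha han hb hbn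
  refine ⟨C.toReal, ENNReal.toReal_nonneg, fun u => norm_le_of_enorm_le hC ?_⟩
  rw [enorm_weightedFourier, enorm_weightedFourier, enorm_weightedFourier]
  exact h (RadialTest.toSchwartz u)

/-- The truncated potential. -/
noncomputable def truncatedPotential (V : E → ℂ) (hV : ContDiff ℝ ∞ V) (hVr : IsRadial V) (R : ℝ)
    (hR : 1 ≤ R) : RadialTest n :=
  RadialTest.mulLeft V hV hVr (scaledCutoff n R (zero_lt_one.trans_le hR))

lemma IsSymbolNegTwo.exists_norm_weightedFourier_tail_le {V : E → ℂ} (hV : ContDiff ℝ ∞ V)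
    (hVr : IsRadial V) (hs : IsSymbolNegTwo V) {t a : ℝ} (ht : 0 ≤ t) (ha : 0 < a)
    (han : a < n / 2) (hn : 2 < n) (hat : a ≤ t + 1) :
    ∃ C : ℝ, 0 ≤ C ∧ ∀ (R : ℝ) (hR : 1 ≤ R) (u : RadialTest n),
      ‖weightedFourier n t ht (RadialTest.mulLeftLinear V hV hVr u) -
        weightedFourier n t ht (RadialTest.mulTest (truncatedPotential V hV hVr R hR) u)‖ ≤
        C * R ^ (-(1 / 2) : ℝ) *
          (‖weightedFourier n a ha.le u‖ + ‖weightedFourier n (t + 1) (by positivity) u‖) := by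
  have hn' : (2 : ℝ) < n := by exact_mod_cast hn
  obtain ⟨C, hC, h⟩ := hs.exists_hsobENorm_tail_le hV hVr ht ha han one_pos le_rfl (by linarith) hat
  refine ⟨C.toReal, ENNReal.toReal_nonneg, fun R hR u => ?_⟩
  have hRp : 0 ≤ R ^ (-(1 / 2) : ℝ) := by positivity
  rw [← map_sub, ← ENNReal.toReal_ofReal hRp, ← ENNReal.toReal_mul]
  refine norm_le_of_enorm_le (ENNReal.mul_ne_top hC ENNReal.ofReal_ne_top) ?_
  rw [enorm_weightedFourier, enorm_weightedFourier, enorm_weightedFourier]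
  exact h R hR u

end WeightedFourier

/-! ### Compactness of multiplication with a loss of one derivative. -/

section Compactness

variable {n : ℕ}

local notation "E" => EuclideanSpace ℝ (Fin n)

variable {X : Type*} [SeminormedAddCommGroup X] [NormedSpace ℂ X]

/-- The product φu lives in a fixed ball, and its L¹ norm is controlled by the norm of order a.
Hence the Fourier transforms are bounded and Lipschitz, uniformly over bounded sets of u. -/
lemma fourierT_mulTest_bounds (φ : RadialTest n) {a : ℝ} (ha : 0 < a) (han : a < n / 2) :
    ∃ M : ℝ, 0 ≤ M ∧ ∀ u : RadialTest n,
      (∀ ξ, ‖fourierT (RadialTest.mulTest φ u).1 ξ‖ ≤ M * ‖weightedFourier n a ha.le u‖) ∧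
      ∀ ξ ξ', ‖fourierT (RadialTest.mulTest φ u).1 ξ - fourierT (RadialTest.mulTest φ u).1 ξ'‖ ≤
        M * ‖ξ - ξ'‖ * ‖weightedFourier n a ha.le u‖ := by
  obtain ⟨C, hC, h⟩ := RadialTest.exists_eLpNorm_one_mul_le φ ha han
  obtain ⟨ρ, hρ⟩ := φ.2.2.1.isCompact.isBounded.subset_closedBall 0
  set c : ℝ := (2 * Real.pi) ^ (-(n : ℝ) / 2) with hc
  have hc0 : 0 ≤ c := by positivity
  have hL : ∀ u : RadialTest n, ∫ x, ‖φ.1 x * u.1 x‖ ≤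
      C.toReal * ‖weightedFourier n a ha.le u‖ := by
    intro u
    have hw : Continuous fun x => φ.1 x * u.1 x := φ.2.1.continuous.mul u.2.1.continuous
    have h' := h u
    rw [eLpNorm_one_eq_lintegral_enorm, ← enorm_weightedFourier ha.le] at h'
    rw [integral_norm_eq_lintegral_enorm hw.aestronglyMeasurable, ← toReal_enorm,
      ← ENNReal.toReal_mul]
    exact ENNReal.toReal_mono (ENNReal.mul_ne_top hC enorm_ne_top) h'
  refine ⟨c * C.toReal * max 1 |ρ|, by positivity, fun u => ⟨fun ξ => ?_, fun ξ ξ' => ?_⟩⟩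
  · calc ‖fourierT (RadialTest.mulTest φ u).1 ξ‖ ≤ c * ∫ x, ‖φ.1 x * u.1 x‖ :=
          norm_fourierT_le _ ξ
      _ ≤ c * (C.toReal * ‖weightedFourier n a ha.le u‖) := by
          gcongr
          exact hL u
      _ = c * C.toReal * 1 * ‖weightedFourier n a ha.le u‖ := by ring
      _ ≤ _ := by
          gcongr
          exact le_max_left _ _
  · have hint : Integrable (RadialTest.mulTest φ u).1 :=
      (RadialTest.toSchwartz (RadialTest.mulTest φ u)).integrable
    have hsupp : ∀ x, (RadialTest.mulTest φ u).1 x ≠ 0 → ‖x‖ ≤ |ρ| := by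
      intro x hx
      have hx' : φ.1 x ≠ 0 := left_ne_zero_of_mul hx
      have := hρ (subset_tsupport _ hx')
      rw [mem_closedBall_zero_iff] at this
      exact this.trans (le_abs_self ρ)
    calc _ ≤ c * ((|ρ| * ‖ξ - ξ'‖) * ∫ x, ‖φ.1 x * u.1 x‖) :=
          norm_fourierT_sub_le hint hsupp ξ ξ'
      _ ≤ c * ((max 1 |ρ| * ‖ξ - ξ'‖) * (C.toReal * ‖weightedFourier n a ha.le u‖)) := by
          gcongr
          · exact le_max_right _ _
          · exact hL u
      _ = _ := by ring

/-- The Fourier transform of `φ u` at `ξ`, as a functional of `u` depending continuously on `ξ`. -/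
lemma exists_continuous_dual_fourierT_mulTest (φ : RadialTest n) {a : ℝ} (ha : 0 < a)
    (han : a < n / 2) (L : X →ₗ[ℂ] RadialTest n)
    (hLa : ∀ u, ‖weightedFourier n a ha.le (L u)‖ ≤ ‖u‖) :
    ∃ k : E → (X →L[ℂ] ℂ), Continuous k ∧
      ∀ ξ u, k ξ u = fourierT (RadialTest.mulTest φ (L u)).1 ξ := by
  obtain ⟨M, hM, hbd⟩ := fourierT_mulTest_bounds φ ha han
  have hex : ∀ ξ : E, ∃ l : X →L[ℂ] ℂ, ∀ u, l u = fourierT (RadialTest.mulTest φ (L u)).1 ξ :=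
    fun ξ => ⟨LinearMap.mkContinuous
      { toFun := fun u => fourierT (RadialTest.mulTest φ (L u)).1 ξ
        map_add' := fun u v => by
          rw [map_add, map_add]
          exact fourierT_add _ _ ξ
        map_smul' := fun c u => by
          rw [map_smul, map_smul]
          exact fourierT_smul c _ ξ } M
      (fun u => ((hbd (L u)).1 ξ).trans (mul_le_mul_of_nonneg_left (hLa u) hM)), fun u => rfl⟩
  choose k hk using hex
  refine ⟨k, ?_, hk⟩
  refine (LipschitzWith.of_dist_le_mul (K := ⟨M, hM⟩) fun ξ ξ' => ?_).continuous
  rw [dist_eq_norm, dist_eq_norm]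
  refine ContinuousLinearMap.opNorm_le_bound _ (mul_nonneg hM (norm_nonneg _)) fun u => ?_
  rw [sub_apply, hk, hk]
  exact ((hbd (L u)).2 ξ ξ').trans
    (mul_le_mul_of_nonneg_left (hLa u) (mul_nonneg hM (norm_nonneg _)))

lemma memLp_indicator_closedBall {F : Type*} [NormedAddCommGroup F] {k : E → F}
    (hk : Continuous k) (r : ℝ) :
    MemLp ((Metric.closedBall (0 : E) r).indicator k) 2 volume := by
  rw [memLp_indicator_iff_restrict Metric.isClosed_closedBall.measurableSet]
  have hK := isCompact_closedBall (0 : E) r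
  obtain ⟨B, hB⟩ := hK.exists_bound_of_continuousOn hk.continuousOn
  have : IsFiniteMeasure (volume.restrict (Metric.closedBall (0 : E) r)) :=
    ⟨by rw [Measure.restrict_apply_univ]; exact hK.measure_lt_top⟩
  have hm : AEStronglyMeasurable k (volume.restrict (Metric.closedBall (0 : E) r)) := by
    have : SecondCountableTopologyEither E F := secondCountableTopologyEither_of_left _ _
    exact hk.aestronglyMeasurable
  refine MemLp.of_bound hm B ?_
  exact (ae_restrict_iff' Metric.isClosed_closedBall.measurableSet).2
    (Filter.Eventually.of_forall fun ξ hξ => hB ξ hξ)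

/-- If `k ξ` represents the Fourier transform at `ξ`, the kernel operator of the truncation of
`|·|ᵗ k` to a ball approximates the weighted Fourier transform. -/
lemma norm_weightedFourier_sub_kernelOperator_le {t : ℝ} (ht : 0 ≤ t) {k : E → (X →L[ℂ] ℂ)}
    {r : ℝ} (hr : 0 < r) (hk : MemLp ((Metric.closedBall (0 : E) r).indicator
      fun ξ => ((‖ξ‖ ^ t : ℝ) : ℂ) • k ξ) 2 volume) (u : X) (w : RadialTest n)
    (hkw : ∀ ξ, k ξ u = fourierT w.1 ξ) :
    ‖weightedFourier n t ht w - kernelOperator (hk.toLp _) u‖ ≤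
      r ^ (-(1 / 2) : ℝ) * ‖weightedFourier n (t + 1 / 2) (by positivity) w‖ := by
  refine Lp.norm_le_mul_norm_of_ae_le_mul ?_
  filter_upwards [Lp.coeFn_sub (weightedFourier n t ht w) (kernelOperator (hk.toLp _) u),
    coeFn_kernelOperator (hk.toLp _) u, hk.coeFn_toLp, coeFn_weightedFourier ht w,
    coeFn_weightedFourier (t := t + 1 / 2) (by positivity) w] with ξ h1 h2 h3 h4 h5
  rw [h1, Pi.sub_apply, h2, h3, h4, h5]
  -- Inside the ball the two functions agree; outside it, 1 ≤ r^{-1/2}|ξ|^{1/2} exchanges half a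
  -- derivative for decay in r.
  by_cases hξ : ξ ∈ Metric.closedBall (0 : E) r
  · rw [Set.indicator_of_mem hξ, smul_apply, hkw, smul_eq_mul, sub_self, norm_zero]
    positivity
  · rw [Set.indicator_of_notMem hξ]
    rw [mem_closedBall_zero_iff, not_le] at hξ
    have hξ0 : 0 < ‖ξ‖ := hr.trans hξ
    rw [zero_apply, sub_zero, norm_mul, norm_mul, Complex.norm_real, Complex.norm_real,
      Real.norm_of_nonneg (by positivity), Real.norm_of_nonneg (by positivity),
      Real.rpow_add hξ0, ← mul_assoc]
    refine mul_le_mul_of_nonneg_right ?_ (norm_nonneg _)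
    have h6 : 1 ≤ r ^ (-(1 / 2) : ℝ) * ‖ξ‖ ^ (1 / 2 : ℝ) := by
      rw [Real.rpow_neg hr.le, inv_mul_eq_div, one_le_div (by positivity)]
      exact Real.rpow_le_rpow hr.le hξ.le (by norm_num)
    calc ‖ξ‖ ^ t ≤ ‖ξ‖ ^ t * (r ^ (-(1 / 2) : ℝ) * ‖ξ‖ ^ (1 / 2 : ℝ)) :=
          le_mul_of_one_le_right (by positivity) h6
      _ = _ := by ring

/-- Multiplication by a test function is compact with a loss of one derivative. -/
lemma isCompactOperator_mulTest (hn : 2 < n) (φ : RadialTest n) {t a : ℝ} (ht : 0 ≤ t)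
    (ha : 0 < a) (han : a < n / 2) (L : X →ₗ[ℂ] RadialTest n)
    (hLa : ∀ u, ‖weightedFourier n a ha.le (L u)‖ ≤ ‖u‖)
    (hLt : ∀ u, ‖weightedFourier n (t + 1) (by positivity) (L u)‖ ≤ ‖u‖)
    {J : X →L[ℂ] Lp ℂ 2 (volume : Measure E)}
    (hJ : ∀ u, J u = weightedFourier n t ht (RadialTest.mulTest φ (L u))) :
    IsCompactOperator J := by
  have hn' : (2 : ℝ) < n := by exact_mod_cast hn
  -- The derivative between t and t + 1 is split in two: b = 1/2 is lost in the product estimate,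
  -- and the other half makes high frequencies small.
  obtain ⟨C, hC, hmul⟩ := RadialTest.exists_norm_weightedFourier_mulTest_le φ
    (t := t + 1 / 2) (b := 1 / 2) (by positivity) ha han (by norm_num) (by linarith)
  obtain ⟨k, hkc, hk⟩ := exists_continuous_dual_fourierT_mulTest φ ha han L hLa
  have hhigh : ∀ u, ‖weightedFourier n (t + 1 / 2) (by positivity)
      (RadialTest.mulTest φ (L u))‖ ≤ 2 * C * ‖u‖ := by
    intro u
    have h1 : t + 1 / 2 + 1 / 2 = t + 1 := by ring
    have h2 := hmul (L u)
    simp only [h1] at h2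
    refine h2.trans ?_
    calc _ ≤ C * (‖u‖ + ‖u‖) := by
          gcongr
          · exact hLa u
          · exact hLt u
      _ = _ := by ring
  have hkm : ∀ r : ℝ, MemLp ((Metric.closedBall (0 : E) r).indicator
      fun ξ => ((‖ξ‖ ^ t : ℝ) : ℂ) • k ξ) 2 volume := fun r =>
    memLp_indicator_closedBall ((Complex.continuous_ofReal.comp
      (continuous_norm.rpow_const fun _ => Or.inr ht)).smul hkc) r
  refine isCompactOperator_of_forall_exists_norm_sub_le fun ε hε => ?_
  obtain ⟨r, hr, hrε⟩ : ∃ r : ℝ, 0 < r ∧ r ^ (-(1 / 2) : ℝ) * (2 * C) ≤ ε := by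
    have h1 := (tendsto_rpow_neg_atTop (y := 1 / 2) (by norm_num)).mul_const (2 * C)
    rw [zero_mul] at h1
    exact ((Filter.eventually_gt_atTop 0).and (h1.eventually_le_const hε)).exists
  refine ⟨kernelOperator ((hkm r).toLp _), isCompactOperator_kernelOperator _, fun u => ?_⟩
  rw [hJ]
  refine (norm_weightedFourier_sub_kernelOperator_le ht hr (hkm r) u _ fun ξ => hk ξ u).trans ?_
  calc _ ≤ r ^ (-(1 / 2) : ℝ) * (2 * C * ‖u‖) :=
        mul_le_mul_of_nonneg_left (hhigh u) (by positivity)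
    _ = r ^ (-(1 / 2) : ℝ) * (2 * C) * ‖u‖ := by ring
    _ ≤ ε * ‖u‖ := mul_le_mul_of_nonneg_right hrε (norm_nonneg u)

/-- Multiplication by a symbol of order `-2` is bounded with a loss of one derivative. -/
lemma IsSymbolNegTwo.exists_norm_weightedFourier_le {V : E → ℂ} (hV : ContDiff ℝ ∞ V)
    (hVr : IsRadial V) (hs : IsSymbolNegTwo V) {t a : ℝ} (ht : 0 ≤ t) (ha : 0 < a)
    (han : a < n / 2) (hn : 2 < n) (hat : a ≤ t + 1) :
    ∃ C : ℝ, 0 ≤ C ∧ ∀ u : RadialTest n,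
      ‖weightedFourier n t ht (RadialTest.mulLeftLinear V hV hVr u)‖ ≤
        C * (‖weightedFourier n a ha.le u‖ + ‖weightedFourier n (t + 1) (by positivity) u‖) := by
  have hn' : (2 : ℝ) < n := by exact_mod_cast hn
  -- V is split at radius 1 into a tail and a test function, each bounded separately.
  obtain ⟨C, hC, h⟩ := hs.exists_norm_weightedFourier_tail_le hV hVr ht ha han hn hat
  obtain ⟨C', hC', h'⟩ := RadialTest.exists_norm_weightedFourier_mulTest_le
    (truncatedPotential V hV hVr 1 le_rfl) ht ha han one_pos (by linarith)
  refine ⟨C + C', by positivity, fun u => ?_⟩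
  have h1 := h 1 le_rfl u
  rw [Real.one_rpow, mul_one] at h1
  rw [add_mul]
  exact (norm_le_norm_sub_add _ _).trans (add_le_add h1 (h' u))

/-- Multiplication by a symbol of order `-2` is compact with a loss of one derivative. -/
lemma IsSymbolNegTwo.isCompactOperator {V : E → ℂ} (hV : ContDiff ℝ ∞ V)
    (hVr : IsRadial V) (hs : IsSymbolNegTwo V) {t a : ℝ} (ht : 0 ≤ t) (ha : 0 < a)
    (han : a < n / 2) (hn : 2 < n) (hat : a ≤ t + 1) (L : X →ₗ[ℂ] RadialTest n)
    (hLa : ∀ u, ‖weightedFourier n a ha.le (L u)‖ ≤ ‖u‖)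
    (hLt : ∀ u, ‖weightedFourier n (t + 1) (by positivity) (L u)‖ ≤ ‖u‖)
    {J : X →L[ℂ] Lp ℂ 2 (volume : Measure E)}
    (hJ : ∀ u, J u = weightedFourier n t ht (RadialTest.mulLeftLinear V hV hVr (L u))) :
    IsCompactOperator J := by
  have hn' : (2 : ℝ) < n := by exact_mod_cast hn
  obtain ⟨C, hC, h⟩ := hs.exists_norm_weightedFourier_tail_le hV hVr ht ha han hn hat
  refine isCompactOperator_of_forall_exists_norm_sub_le fun ε hε => ?_
  -- R is taken so large that the tail, of norm at most 2C R^{-1/2}, falls below ε; the truncated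
  -- potential is a test function and gives a compact operator.
  obtain ⟨R, hR, hRε⟩ : ∃ R : ℝ, 1 ≤ R ∧ R ^ (-(1 / 2) : ℝ) * (2 * C) ≤ ε := by
    have h1 := (tendsto_rpow_neg_atTop (y := 1 / 2) (by norm_num)).mul_const (2 * C)
    rw [zero_mul] at h1
    exact ((Filter.eventually_ge_atTop 1).and (h1.eventually_le_const hε)).exists
  set φ := truncatedPotential V hV hVr R hR with hφ
  obtain ⟨C', hC', h'⟩ := RadialTest.exists_norm_weightedFourier_mulTest_le φ ht ha han one_pos
    (by linarith)
  set S : X →L[ℂ] Lp ℂ 2 (volume : Measure E) := LinearMap.mkContinuous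
    ((weightedFourier n t ht).comp ((RadialTest.mulTest φ).comp L)) (2 * C') (fun u => by
      refine (h' (L u)).trans ?_
      calc _ ≤ C' * (‖u‖ + ‖u‖) := by
            gcongr
            · exact hLa u
            · exact hLt u
        _ = _ := by ring) with hS
  have hSu : ∀ u, S u = weightedFourier n t ht (RadialTest.mulTest φ (L u)) := fun u => rfl
  refine ⟨S, isCompactOperator_mulTest hn φ ht ha han L hLa hLt hSu, fun u => ?_⟩
  rw [hJ, hSu]
  refine (h R hR (L u)).trans ?_
  calc _ ≤ C * R ^ (-(1 / 2) : ℝ) * (‖u‖ + ‖u‖) := by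
        gcongr
        · exact hLa u
        · exact hLt u
    _ = R ^ (-(1 / 2) : ℝ) * (2 * C) * ‖u‖ := by ring
    _ ≤ ε * ‖u‖ := by gcongr

end Compactness

/-! ### Passing compactness to the completion. -/

section CompactCompletion

variable {X : Type*} [SeminormedAddCommGroup X] [NormedSpace ℂ X]

/-- Totally bounded sets have compact closure in the completion. The closure of the embedded unit
ball is a neighbourhood of 0, and by continuity it is mapped into that compact set. -/
lemma isCompactOperator_completion_of_totallyBounded {T : X →L[ℂ] X}
    (hT : TotallyBounded (T '' Metric.ball 0 1)) : IsCompactOperator T.completion := by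
  set c : X → UniformSpace.Completion X := fun x => x with hc
  refine ⟨closure (c '' (T '' Metric.ball 0 1)), ?_, ?_⟩
  · exact isCompact_iff_totallyBounded_isComplete.2
      ⟨(hT.image (UniformSpace.Completion.uniformContinuous_coe X)).closure,
        isClosed_closure.isComplete⟩
  · have h1 : closure (c '' Metric.ball 0 1) ∈ nhds (c 0) :=
      UniformSpace.Completion.isDenseInducing_coe.closure_image_mem_nhds
        (Metric.ball_mem_nhds 0 one_pos)
    have hc0 : c 0 = 0 := UniformSpace.Completion.coe_zero
    rw [hc0] at h1
    refine Filter.mem_of_superset h1 ?_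
    refine (closure_minimal ?_ (isClosed_closure.preimage T.completion.continuous))
    rintro _ ⟨x, hx, rfl⟩
    refine subset_closure ⟨T x, ⟨x, hx, rfl⟩, ?_⟩
    exact (ContinuousLinearMap.completion_apply_coe T x).symm

/-- A finite net for the image of the ball under (J₁, J₂) pulls back to points of the ball, and the
norm inequality applied to differences makes their T-images a net. No completeness of Y is required.
-/
lemma totallyBounded_image_of_isCompactOperator {Y Z : Type*} [SeminormedAddCommGroup Y]
    [NormedSpace ℂ Y] [NormedAddCommGroup Z] [NormedSpace ℂ Z] {T : X →L[ℂ] Y}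
    {J₁ J₂ : X →L[ℂ] Z} (h₁ : IsCompactOperator J₁) (h₂ : IsCompactOperator J₂)
    (hT : ∀ x, ‖T x‖ ≤ ‖J₁ x‖ + ‖J₂ x‖) : TotallyBounded (T '' Metric.ball 0 1) := by
  obtain ⟨K₁, hK₁, hJ₁⟩ := IsCompactOperator.image_ball_subset_compact
    (f := J₁.toLinearMap) h₁ 1
  obtain ⟨K₂, hK₂, hJ₂⟩ := IsCompactOperator.image_ball_subset_compact
    (f := J₂.toLinearMap) h₂ 1
  have htb : TotallyBounded ((J₁.prod J₂) '' Metric.ball 0 1) := by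
    refine (hK₁.prod hK₂).totallyBounded.subset ?_
    rintro _ ⟨x, hx, rfl⟩
    exact ⟨hJ₁ ⟨x, hx, rfl⟩, hJ₂ ⟨x, hx, rfl⟩⟩
  refine Metric.totallyBounded_iff.2 fun ε hε => ?_
  -- The centres lie in the image itself, so they can be lifted; radius ε/2 is used because two
  -- norms are added.
  obtain ⟨t, htsub, htfin, htcov⟩ := Metric.finite_approx_of_totallyBounded htb (ε / 2)
    (by positivity)
  obtain ⟨s, hs, hsfin, htcov⟩ := Set.exists_subset_image_finite_and
    (p := fun t => _ ⊆ ⋃ y ∈ t, Metric.ball y (ε / 2)).1 ⟨t, htsub, htfin, htcov⟩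
  refine ⟨T '' s, hsfin.image T, ?_⟩
  rintro _ ⟨x, hx, rfl⟩
  obtain ⟨_, ⟨y, hy, rfl⟩, hxy⟩ := Set.mem_iUnion₂.1 (htcov ⟨x, hx, rfl⟩)
  refine Set.mem_iUnion₂.2 ⟨T y, ⟨y, hy, rfl⟩, ?_⟩
  rw [Metric.mem_ball, dist_eq_norm] at hxy ⊢
  rw [← map_sub] at hxy ⊢
  have e1 : ‖J₁ (x - y)‖ < ε / 2 := (norm_fst_le ((J₁.prod J₂) (x - y))).trans_lt hxy
  have e2 : ‖J₂ (x - y)‖ < ε / 2 := (norm_snd_le ((J₁.prod J₂) (x - y))).trans_lt hxy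
  exact (hT (x - y)).trans_lt (by linarith)

end CompactCompletion

/-! ### The energy norm in terms of weighted Fourier transforms. -/

section EnergyNorm

variable {n : ℕ} {s₁ s₂ : ℝ} {h₁ : 1 ≤ s₁} {h : s₁ ≤ s₂}

lemma re_interInner_self {r₁ r₂ : ℝ} (hr₁ : 0 ≤ r₁) (hr₂ : 0 ≤ r₂) (u : RadialTest n) :
    RCLike.re (interInner r₁ r₂ u.1 u.1) = ‖weightedFourier n r₁ hr₁ u‖ ^ 2 +
      if r₁ < r₂ then ‖weightedFourier n r₂ hr₂ u‖ ^ 2 else 0 := by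
  unfold interInner
  rw [map_add, re_hsobInner_self hr₁]
  split_ifs
  · rw [re_hsobInner_self hr₂]
  · simp

lemma TestPair.norm_sq (u : TestPair n s₁ s₂ h₁ h) :
    ‖u‖ ^ 2 = RCLike.re (interInner s₁ s₂ u.fst.1 u.fst.1) +
      RCLike.re (interInner (s₁ - 1) (s₂ - 1) u.snd.1 u.snd.1) := by
  rw [← inner_self_eq_norm_sq (𝕜 := ℂ), TestPair.inner_def, map_add]

lemma TestPair.norm_weightedFourier_fst_le (u : TestPair n s₁ s₂ h₁ h) :
    ‖weightedFourier n s₁ (by linarith) u.fst‖ ≤ ‖u‖ := by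
  refine le_of_sq_le_sq ?_ (norm_nonneg u)
  have h2 := interInner_self_nonneg (s₁ - 1) (s₂ - 1) u.snd.1
  rw [TestPair.norm_sq, re_interInner_self (by linarith) (by linarith)]
  split_ifs <;> nlinarith [sq_nonneg ‖weightedFourier n s₂ (by linarith) u.fst‖]

lemma TestPair.norm_weightedFourier_fst_le' (u : TestPair n s₁ s₂ h₁ h) :
    ‖weightedFourier n s₂ (by linarith) u.fst‖ ≤ ‖u‖ := by
  -- When the orders coincide the inner product has no second term, and the bound for the first
  -- order applies.
  rcases h.eq_or_lt with rfl | hlt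
  · exact u.norm_weightedFourier_fst_le
  refine le_of_sq_le_sq ?_ (norm_nonneg u)
  have h2 := interInner_self_nonneg (s₁ - 1) (s₂ - 1) u.snd.1
  rw [TestPair.norm_sq, re_interInner_self (by linarith) (by linarith), if_pos hlt]
  nlinarith [sq_nonneg ‖weightedFourier n s₁ (by linarith) u.fst‖]

lemma TestPair.norm_mk_zero_le (v : RadialTest n) :
    ‖(TestPair.mk 0 v : TestPair n s₁ s₂ h₁ h)‖ ≤
      ‖weightedFourier n (s₁ - 1) (by linarith) v‖ +
        ‖weightedFourier n (s₂ - 1) (by linarith) v‖ := by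
  refine le_of_sq_le_sq ?_ (by positivity)
  rw [TestPair.norm_sq]
  change RCLike.re (interInner s₁ s₂ (0 : RadialTest n).1 (0 : RadialTest n).1) +
    RCLike.re (interInner (s₁ - 1) (s₂ - 1) v.1 v.1) ≤ _
  rw [re_interInner_self (by linarith) (by linarith), re_interInner_self (by linarith) (by linarith),
    map_zero, map_zero, norm_zero]
  have a1 := norm_nonneg (weightedFourier n (s₁ - 1) (by linarith) v)
  have a2 := norm_nonneg (weightedFourier n (s₂ - 1) (by linarith) v)
  split_ifs <;> nlinarith

/-- The first component, as a linear map. -/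
def TestPair.fstLinear : TestPair n s₁ s₂ h₁ h →ₗ[ℂ] RadialTest n :=
  LinearMap.fst ℂ (RadialTest n) (RadialTest n)

/-- The map `v ↦ (0, v)`. -/
def TestPair.inrLinear : RadialTest n →ₗ[ℂ] TestPair n s₁ s₂ h₁ h :=
  LinearMap.inr ℂ (RadialTest n) (RadialTest n)

end EnergyNorm

/-! ### Assembly on the energy space. -/

theorem lemma4p1 (n : ℕ) (s₁ s₂ : ℝ) (hn : 5 ≤ n) (hs₁ : 1 < s₁) (hs₁n : s₁ < (n : ℝ) / 2)
    (hs : s₁ ≤ s₂) (V : EuclideanSpace ℝ (Fin n) → ℂ) (hV : ContDiff ℝ ∞ V) (hVr : IsRadial V)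
    (hdecay : ∀ k : ℕ, ∃ C : ℝ, ∀ x : EuclideanSpace ℝ (Fin n),
      ‖iteratedFDeriv ℝ k V x‖ ≤ C * Real.sqrt (1 + ‖x‖ ^ 2) ^ (-2 - (k : ℝ))) :
    ∃ T : EnergySpace n s₁ s₂ hs₁.le hs →L[ℂ] EnergySpace n s₁ s₂ hs₁.le hs,
      (∀ u₁ u₂ : RadialTest n,
        T ((TestPair.mk u₁ u₂ : TestPair n s₁ s₂ hs₁.le hs) : EnergySpace n s₁ s₂ hs₁.le hs) =
          ((TestPair.mk 0 (RadialTest.mulLeft V hV hVr u₁) : TestPair n s₁ s₂ hs₁.le hs) :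
            EnergySpace n s₁ s₂ hs₁.le hs)) ∧
      (s₂ < (n : ℝ) / 2 → IsCompactOperator T) := by
  have hsym := isSymbolNegTwo_of_decay hdecay
  have hn2 : 2 < n := by omega
  have ha : 0 < s₁ := by linarith
  have ht₁ : 0 ≤ s₁ - 1 := by linarith
  have ht₂ : 0 ≤ s₂ - 1 := by linarith
  set L : TestPair n s₁ s₂ hs₁.le hs →ₗ[ℂ] RadialTest n := TestPair.fstLinear with hL
  set M := RadialTest.mulLeftLinear V hV hVr with hM
  have hLa : ∀ u, ‖weightedFourier n s₁ ha.le (L u)‖ ≤ ‖u‖ := fun u =>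
    u.norm_weightedFourier_fst_le
  have hL₁ : ∀ u, ‖weightedFourier n (s₁ - 1 + 1) (by linarith) (L u)‖ ≤ ‖u‖ := by
    simp only [sub_add_cancel]
    exact hLa
  have hL₂ : ∀ u, ‖weightedFourier n (s₂ - 1 + 1) (by linarith) (L u)‖ ≤ ‖u‖ := by
    simp only [sub_add_cancel]
    exact fun u => u.norm_weightedFourier_fst_le'
  -- Both target orders use the same low order a = s₁ < n/2. Only a and the loss 1 must lie below
  -- n/2, so t is free to be large.
  have hex : ∀ t, ∀ ht : 0 ≤ t, s₁ ≤ t + 1 →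
      (∀ u, ‖weightedFourier n (t + 1) (by linarith) (L u)‖ ≤ ‖u‖) →
      ∃ C : ℝ, ∀ u, ‖weightedFourier n t ht (M (L u))‖ ≤ C * ‖u‖ := by
    intro t ht hat hLt
    obtain ⟨C, hC, hb⟩ := hsym.exists_norm_weightedFourier_le hV hVr ht ha hs₁n hn2 hat
    refine ⟨C * 2, fun u => (hb (L u)).trans ?_⟩
    rw [mul_assoc, two_mul]
    exact mul_le_mul_of_nonneg_left (add_le_add (hLa u) (hLt u)) hC
  obtain ⟨C₁, hC₁⟩ := hex (s₁ - 1) ht₁ (by linarith) hL₁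
  obtain ⟨C₂, hC₂⟩ := hex (s₂ - 1) ht₂ (by linarith) hL₂
  set J₁ := LinearMap.mkContinuous ((weightedFourier n (s₁ - 1) ht₁).comp (M.comp L)) C₁ hC₁
  set J₂ := LinearMap.mkContinuous ((weightedFourier n (s₂ - 1) ht₂).comp (M.comp L)) C₂ hC₂
  -- The norm of (0, Vu₁) is dominated by its two L² components, so compactness need only be checked
  -- for the maps into L².
  have hT : ∀ u, ‖TestPair.inrLinear (h₁ := hs₁.le) (h := hs) (M (L u))‖ ≤ ‖J₁ u‖ + ‖J₂ u‖ :=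
    fun u => TestPair.norm_mk_zero_le (M (L u))
  set T₀ : TestPair n s₁ s₂ hs₁.le hs →L[ℂ] TestPair n s₁ s₂ hs₁.le hs :=
    LinearMap.mkContinuous (TestPair.inrLinear.comp (M.comp L)) (C₁ + C₂) (fun u => by
      rw [add_mul]
      exact (hT u).trans (add_le_add (hC₁ u) (hC₂ u)))
  refine ⟨T₀.completion, fun u₁ u₂ => ContinuousLinearMap.completion_apply_coe T₀ _, fun _ => ?_⟩
  refine isCompactOperator_completion_of_totallyBounded
    (totallyBounded_image_of_isCompactOperator (J₁ := J₁) (J₂ := J₂) ?_ ?_ hT)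
  · exact hsym.isCompactOperator hV hVr ht₁ ha hs₁n hn2 (by linarith) L hLa hL₁ fun u => rfl
  · exact hsym.isCompactOperator hV hVr ht₂ ha hs₁n hn2 (by linarith) L hLa hL₂ fun u => rfl
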